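/- **Notation.** $\omega_\times$ is the skew-symmetric matrix of $v\mapsto\omega\times v$ on $\mathbb R^3$; $|\cdot|$ is the Euclidean norm, $\|\cdot\|$ the Frobenius norm; $\mathrm{SE}(3)$ is the group of matrices $\begin{bmatrix}R&p\\0&1\end{bmatrix}$ with $R\in\mathrm{SO}(3)$, $p\in\mathbb R^3$; $\mathfrak{se}(3)$ is the space of matrices $\begin{bmatrix}\Omega_\times&V\\0&0\end{bmatrix}$ with $\Omega,V\in\mathbb R^3$; $\mathbf P:\mathbb R^{4\times4}\to\mathfrak{se}(3)$ is the orthogonal projection. For $y\in\mathbb R^4$ write $y=(\underline y,y_4)$ with $\underline y\in\mathbb R^3$. For $\delta>0$, $\mathrm{sat}_\delta(x):=x\min(1,\delta/|x|)$ on $\mathbb R^3$, with $\mathrm{sat}_\delta(0)=0$. **Setting.** Let $A:[0,\infty)\to\mathfrak{se}(3)$ be continuous and bounded, and let $X:[0,\infty)\to\mathrm{SE}(3)$ be a bounded solution of $\dot X=XA$. Let $\mathring y_1,\dots,\mathring y_N\in\mathbb R^4$ be unit vectors, representing points of $\mathbb{RP}^3$, and $y_i(t):=X^{-1}\mathring y_i/|X^{-1}\mathring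 y_i|$. Let $k_1,\dots,k_N,k_b,\kappa_\Omega,\kappa_V,\delta_\Omega,\delta_V>0$, and let $b_\Omega,b_V\in\mathbb R^3$ be constant vectors with $|b_\Omega|\le\delta_\Omega$ and $|b_V|\le\delta_V$. Put $b_A:=\begin{bmatrix}(b_\Omega)_\times&b_V\\0&0\end{bmatrix}$ and $A_y:=A+b_A$ (the biased velocity measurement). **Assumption (observability).** Let $v_{jl}:=\mathring y_{l,4}\,\underline{\mathring y}_j-\mathring y_{j,4}\,\underline{\mathring y}_l$. "Different" means different as points of $\mathbb{RP}^3$, and vectors are collinear if they lie on one line through $0$. One of the following holds: (1) there are two different points $\mathring y_{i_1},\mathring y_{i_2}$ with zero fourth component and a point $\mathring y_{j_1}$ with $\mathring y_{j_1,4}\ne0$; (2) there are a point $\mathring y_{i_1}$ with $\mathring y_{i_1,4}=0$ and two different points $\mathring y_{j_1},\mathring y_{j_2}$ with nonzero fourth components, such that $\underline{\mathring y}_{i_1}$ and $v_{j_1j_2}$ are not collinear; (3) there are three pairwise different points $\mathring y_{j_1},\mathring y_{j_2},\mathring y_{j_3}$ with nonzero fourth components, such that $v_{j_1j_2},v_{j_2j_3},v_{j_3j_1}$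 are not all collinear. **Assumption (rank).** The matrices $\mathring G:=\sum_ik_i(\underline{\mathring y}_{i\times})^2$ and $\mathring H:=S\,\mathring G^{-1}S-\sum_ik_i\mathring y_{i,4}^2(I_3-\underline{\mathring y}_i\underline{\mathring y}_i^\top)$ are invertible, where $S:=\sum_ik_i\mathring y_{i,4}\,\underline{\mathring y}_{i\times}$. **Observer.** With $\hat X=\begin{bmatrix}\hat R&\hat p\\0&1\end{bmatrix}\in\mathrm{SE}(3)$, $\hat b_\Omega,\hat b_V\in\mathbb R^3$, $\hat b_A:=\begin{bmatrix}(\hat b_\Omega)_\times&\hat b_V\\0&0\end{bmatrix}$, $e_i:=\hat Xy_i/|\hat Xy_i|$, $\Delta:=-\mathbf P\big(\sum_ik_i(I_4-e_ie_i^\top)\mathring y_ie_i^\top\big)$, $V_\Delta:=\sum_ik_ie_{i,4}\big((e_i^\top\mathring y_i)\underline e_i-\underline{\mathring y}_i\big)$ and $\Omega_\Delta:=-\tfrac12\sum_ik_i\,\underline e_i\times\underline{\mathring y}_i$, consider $$\dot{\hat X}=\hat X(A_y-\hat b_A)-\Delta\hat X,$$ $$\dot{\hat b}_\Omega=k_b\hat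 R^\top\big(\Omega_\Delta+\tfrac12V_\Delta\times\hat p\big)-\kappa_\Omega\big(\hat b_\Omega-\mathrm{sat}_{\delta_\Omega}(\hat b_\Omega)\big),\qquad \dot{\hat b}_V=k_b\hat R^\top V_\Delta-\kappa_V\big(\hat b_V-\mathrm{sat}_{\delta_V}(\hat b_V)\big).$$ **Claim.** Let $E:=\hat XX^{-1}$ and $\tilde b_A:=b_A-\hat b_A$. Then $(E,\tilde b_A)=(I_4,0)$ is a locally asymptotically stable equilibrium of the dynamics of $(E,\tilde b_A)$ on $\mathrm{SE}(3)\times\mathfrak{se}(3)$. That is, it is an equilibrium and, for every initial time $t_0\ge0$: solutions from all initial states close enough to $(I_4,0)$ exist on $[t_0,\infty)$; for every $\varepsilon>0$ there is $\delta>0$ such that every solution starting at $t_0$ within distance $\delta$ of $(I_4,0)$ stays within distance $\varepsilon$; and every solution on $[t_0,\infty)$ starting close enough to $(I_4,0)$ converges to $(I_4,0)$ as $t\to\infty$. -/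

import Mathlib

open Set Filter Topology
open scoped Matrix

/- Matrices carry the Frobenius norm `‖M‖ = √(tr (Mᵀ M))`. -/
attribute [local instance] Matrix.frobeniusNormedAddCommGroup Matrix.frobeniusNormedSpace

noncomputable section

namespace PoseObserver

/-- Vectors of `ℝ³`. -/
abbrev Vec3 := Fin 3 → ℝ

/-- Vectors of `ℝ⁴ = ℝ³ ⊕ ℝ`: three leading components and a fourth one. -/
abbrev Vec4 := Fin 3 ⊕ Unit → ℝ

/-- Real `3 × 3` matrices. -/
abbrev Mat3 := Matrix (Fin 3) (Fin 3) ℝ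

/-- Real `4 × 4` matrices, with the block structure `4 = 3 + 1`. -/
abbrev Mat4 := Matrix (Fin 3 ⊕ Unit) (Fin 3 ⊕ Unit) ℝ

/-- The Euclidean norm `|v|`. -/
def eNorm {ι : Type*} [Fintype ι] (v : ι → ℝ) : ℝ := √(v ⬝ᵥ v)

/-- `v / |v|`. -/
def normalize {ι : Type*} [Fintype ι] (v : ι → ℝ) : ι → ℝ := (eNorm v)⁻¹ • v

/-- The first three components of a vector of `ℝ⁴`. -/
def vecPart (y : Vec4) : Vec3 := fun i => y (Sum.inl i)

/-- The fourth component of a vector of `ℝ⁴`. -/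
def fourth (y : Vec4) : ℝ := y (Sum.inr ())

/-- The skew-symmetric matrix `ω_×` of the cross product by `ω`. -/
def skew (ω : Vec3) : Mat3 :=
  !![0, -ω 2, ω 1; ω 2, 0, -ω 0; -ω 1, ω 0, 0]

theorem skew_mulVec (ω v : Vec3) : skew ω *ᵥ v = crossProduct ω v := by
  ext i
  fin_cases i <;> simp [skew, crossProduct, Matrix.mulVec, dotProduct, Fin.sum_univ_three] <;> ring

/-- The matrix `[R p; 0 1]`. -/
def pose (R : Mat3) (p : Vec3) : Mat4 :=
  Matrix.fromBlocks R (Matrix.replicateCol Unit p) 0 1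

/-- The special Euclidean group `SE(3)`. -/
def SE3 : Set Mat4 :=
  {X | ∃ R ∈ Matrix.specialOrthogonalGroup (Fin 3) ℝ, ∃ p : Vec3, X = pose R p}

/-- The matrix `[Ω_× V; 0 0]`. -/
def twist (Ω V : Vec3) : Mat4 :=
  Matrix.fromBlocks (skew Ω) (Matrix.replicateCol Unit V) 0 0

/-- The Lie algebra `𝔰𝔢(3)`. -/
def se3 : Set Mat4 := {A | ∃ Ω V : Vec3, A = twist Ω V}

/-- The rotation block of a `4 × 4` matrix. -/
def rotPart (X : Mat4) : Mat3 := X.toBlocks₁₁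

/-- The translation column of a `4 × 4` matrix. -/
def posPart (X : Mat4) : Vec3 := fun i => X (Sum.inl i) (Sum.inr ())

/-- The orthogonal projection of `ℝ^{4×4}` onto `𝔰𝔢(3)`: the upper left block is replaced by its
anti-symmetric part, and the last row by zero. -/
def projSe3 (M : Mat4) : Mat4 :=
  Matrix.fromBlocks ((1 / 2 : ℝ) • (M.toBlocks₁₁ - M.toBlocks₁₁ᵀ)) M.toBlocks₁₂ 0 0

/-- The output `h(X, y) = X⁻¹ y / |X⁻¹ y|`. -/
def output (X : Mat4) (y : Vec4) : Vec4 := normalize (X⁻¹ *ᵥ y)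

/-- The output error `e = Xh y / |Xh y|` of a measurement `y`, with `Xh` the pose estimate. -/
def outErr (Xh : Mat4) (y : Vec4) : Vec4 := normalize (Xh *ᵥ y)

/-- The innovation `Δ(Xh, Y) = -P (∑ kᵢ (I₄ - eᵢ eᵢᵀ) ẙᵢ eᵢᵀ)`, where `eᵢ = Xh yᵢ / |Xh yᵢ|`. -/
def innovation {N : ℕ} (yo : Fin N → Vec4) (k : Fin N → ℝ) (Xh : Mat4) (Y : Fin N → Vec4) :
    Mat4 :=
  -projSe3 (∑ i, k i •
    ((1 - Matrix.vecMulVec (outErr Xh (Y i)) (outErr Xh (Y i))) *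
      Matrix.vecMulVec (yo i) (outErr Xh (Y i))))

/-- `V_Δ = ∑ kᵢ e_{i,4} ((eᵢᵀ ẙᵢ) e̲ᵢ - ẙ̲ᵢ)`. -/
def innovV {N : ℕ} (yo : Fin N → Vec4) (k : Fin N → ℝ) (Xh : Mat4) (Y : Fin N → Vec4) : Vec3 :=
  ∑ i, (k i * fourth (outErr Xh (Y i))) •
    ((outErr Xh (Y i) ⬝ᵥ yo i) • vecPart (outErr Xh (Y i)) - vecPart (yo i))

/-- `Ω_Δ = -(1/2) ∑ kᵢ e̲ᵢ × ẙ̲ᵢ`. -/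
def innovOmega {N : ℕ} (yo : Fin N → Vec4) (k : Fin N → ℝ) (Xh : Mat4) (Y : Fin N → Vec4) : Vec3 :=
  -((1 / 2 : ℝ) • ∑ i, k i • crossProduct (vecPart (outErr Xh (Y i))) (vecPart (yo i)))

/-- The saturation `sat_δ(x) = x min(1, δ/|x|)`. -/
def sat (δ : ℝ) (x : Vec3) : Vec3 := min 1 (δ / eNorm x) • x

/-- `ẙ₁` and `ẙ₂` (unit vectors) represent different points of the real projective space. -/
def ProjDistinct (y₁ y₂ : Vec4) : Prop := y₁ ≠ y₂ ∧ y₁ ≠ -y₂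

/-- `v = ẙ_{2,4} ẙ̲₁ - ẙ_{1,4} ẙ̲₂`. -/
def resultant (y₁ y₂ : Vec4) : Vec3 := fourth y₂ • vecPart y₁ - fourth y₁ • vecPart y₂

/-- Observability of the family of reference points. Collinearity of vectors means that they lie on
one line through the origin. -/
def Observable {N : ℕ} (yo : Fin N → Vec4) : Prop :=
  (∃ i₁ i₂ j₁, ProjDistinct (yo i₁) (yo i₂) ∧ fourth (yo i₁) = 0 ∧ fourth (yo i₂) = 0 ∧
    fourth (yo j₁) ≠ 0) ∨
  (∃ i₁ j₁ j₂, fourth (yo i₁) = 0 ∧ ProjDistinct (yo j₁) (yo j₂) ∧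
    fourth (yo j₁) ≠ 0 ∧ fourth (yo j₂) ≠ 0 ∧
    ¬ Collinear ℝ {0, vecPart (yo i₁), resultant (yo j₁) (yo j₂)}) ∨
  (∃ j₁ j₂ j₃, ProjDistinct (yo j₁) (yo j₂) ∧ ProjDistinct (yo j₂) (yo j₃) ∧
    ProjDistinct (yo j₃) (yo j₁) ∧
    fourth (yo j₁) ≠ 0 ∧ fourth (yo j₂) ≠ 0 ∧ fourth (yo j₃) ≠ 0 ∧
    ¬ Collinear ℝ {0, resultant (yo j₁) (yo j₂), resultant (yo j₂) (yo j₃),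
      resultant (yo j₃) (yo j₁)})

/-- `G = ∑ kᵢ (ẙ̲ᵢ_×)²`. -/
def matG {N : ℕ} (yo : Fin N → Vec4) (k : Fin N → ℝ) : Mat3 :=
  ∑ i, k i • skew (vecPart (yo i)) ^ 2

/-- `S = ∑ kᵢ ẙ_{i,4} ẙ̲ᵢ_×`. -/
def matS {N : ℕ} (yo : Fin N → Vec4) (k : Fin N → ℝ) : Mat3 :=
  ∑ i, (k i * fourth (yo i)) • skew (vecPart (yo i))

/-- `H = S G⁻¹ S - ∑ kᵢ ẙ_{i,4}² (I₃ - ẙ̲ᵢ ẙ̲ᵢᵀ)`. -/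
def matH {N : ℕ} (yo : Fin N → Vec4) (k : Fin N → ℝ) : Mat3 :=
  matS yo k * (matG yo k)⁻¹ * matS yo k -
    ∑ i, (k i * fourth (yo i) ^ 2) •
      (1 - Matrix.vecMulVec (vecPart (yo i)) (vecPart (yo i)))

/-- `(Xh, bhΩ, bhV)` is, on the time interval `J`, a solution of the observer with anti-windup bias
integrator, driven by the true pose `X` (through the outputs `yᵢ = h(X, ẙᵢ)`) and by the
measured velocity `A + b_A`, where `b_A = [bΩ_× bV; 0 0]`. -/
structure IsObserverSolution {N : ℕ} (yo : Fin N → Vec4) (k : Fin N → ℝ) (kb κΩ κV δΩ δV : ℝ)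
    (A X : ℝ → Mat4) (bΩ bV : Vec3) (J : Set ℝ)
    (Xh : ℝ → Mat4) (bhΩ bhV : ℝ → Vec3) : Prop where
  mem_SE3 : ∀ t ∈ J, Xh t ∈ SE3
  deriv_pose : ∀ t ∈ J, HasDerivWithinAt Xh
    (Xh t * ((A t + twist bΩ bV) - twist (bhΩ t) (bhV t)) -
      innovation yo k (Xh t) (fun i => output (X t) (yo i)) * Xh t) J t
  deriv_biasΩ : ∀ t ∈ J, HasDerivWithinAt bhΩ
    (kb • ((rotPart (Xh t))ᵀ *ᵥ
        (innovOmega yo k (Xh t) (fun i => output (X t) (yo i)) +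
          (1 / 2 : ℝ) • crossProduct (innovV yo k (Xh t) (fun i => output (X t) (yo i)))
            (posPart (Xh t)))) -
      κΩ • (bhΩ t - sat δΩ (bhΩ t))) J t
  deriv_biasV : ∀ t ∈ J, HasDerivWithinAt bhV
    (kb • ((rotPart (Xh t))ᵀ *ᵥ innovV yo k (Xh t) (fun i => output (X t) (yo i))) -
      κV • (bhV t - sat δV (bhV t))) J t

/-- The motions, on the time interval `J`, of the error system with state
`(E, b̃_A) = (Xh X⁻¹, b_A - bh_A)`. -/
def IsErrorMotion {N : ℕ} (yo : Fin N → Vec4) (k : Fin N → ℝ) (kb κΩ κV δΩ δV : ℝ)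
    (A X : ℝ → Mat4) (bΩ bV : Vec3) (J : Set ℝ) (x : ℝ → Mat4 × Mat4) : Prop :=
  ∃ (Xh : ℝ → Mat4) (bhΩ bhV : ℝ → Vec3),
    IsObserverSolution yo k kb κΩ κV δΩ δV A X bΩ bV J Xh bhΩ bhV ∧
    ∀ t ∈ J, x t = (Xh t * (X t)⁻¹, twist bΩ bV - twist (bhΩ t) (bhV t))

/-- Local asymptotic stability of the point `xe`, for a possibly time-varying system on the state
space `M` for times `t ≥ 0`, given by its motions (`motion J x`: the curve `x` is a motion of the
system on the interval `J`): `xe` is an equilibrium and, for every initial time `t₀`, motions from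
nearby initial states exist on `[t₀, ∞)`, `xe` is Lyapunov stable, and it is attractive. -/
structure LocallyAsymptoticallyStable {S : Type*} [PseudoMetricSpace S] (M : Set S)
    (motion : Set ℝ → (ℝ → S) → Prop) (xe : S) : Prop where
  mem : xe ∈ M
  equilibrium : ∀ t₀ : ℝ, 0 ≤ t₀ → motion (Ici t₀) (fun _ => xe)
  exists_motion : ∀ t₀ : ℝ, 0 ≤ t₀ → ∃ r > 0, ∀ x₀ ∈ M, dist x₀ xe < r →
    ∃ x, motion (Ici t₀) x ∧ x t₀ = x₀
  stable : ∀ t₀ : ℝ, 0 ≤ t₀ → ∀ ε > 0, ∃ δ > 0, ∀ T : ℝ, t₀ ≤ T → ∀ x,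
    motion (Icc t₀ T) x → dist (x t₀) xe < δ → ∀ t ∈ Icc t₀ T, dist (x t) xe < ε
  attractive : ∀ t₀ : ℝ, 0 ≤ t₀ → ∃ c > 0, ∀ x,
    motion (Ici t₀) x → dist (x t₀) xe < c → Tendsto x atTop (𝓝 xe)

end PoseObserver

end

/-! The Lyapunov function is `L = ∑ kᵢ (1 - eᵢ ⬝ ẙᵢ) + ‖b̃_A‖² / (2 k_b)`. The `eᵢ` depend on the
state only through `E`, and `Δ` is the gradient of the first term: along `E' = U E` with `U ∈ 𝔰𝔢(3)`
it varies at the rate `⟨U, Δ⟩` (Frobenius). Here `U = X̂ b̃_A X̂⁻¹ - Δ`. The bias law is chosen so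
that the bias energy cancels the contribution of `X̂ b̃_A X̂⁻¹`, and the anti-windup terms can only
lower `L` because the true biases lie in the saturation balls. Hence `L' ≤ -‖Δ‖²`
(`IsErrSolution.exists_hasDerivWithinAt_lyapunov`).

Observability makes this useful. The linearization of `Δ` at the identity, paired with a twist `Z`,
gives `∑ kᵢ |(1 - ẙᵢẙᵢᵀ) Z ẙᵢ|²`. It vanishes only if every `Z ẙᵢ` is parallel to `ẙᵢ`, in fact
zero, and then `Z = 0` (`Observable.eq_zero`). So `‖Δ‖ ≥ c ‖E - 1‖` on `SE(3)` near the identity;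
since also `‖Δ‖² ≤ C ∑ kᵢ (1 - eᵢ ⬝ ẙᵢ)`, the misalignment dominates `‖E - 1‖²` as well
(`exists_coercive`). Sublevel sets of `L` then give stability, with constants independent of the
initial time, and confinement to a ball gives global existence (`exists_isErrSolution`).

The system depends on time through `X`, so attractivity is obtained by Barbalat-type arguments. From
`L' ≤ -c ‖E - 1‖²` and the Lipschitz continuity of `E` follows `E → 1`. Next `E' = q + ρ` with `q =
X b̃_A X⁻¹`, where `ρ → 0` and `q` is Lipschitz because `A` and `X` are bounded. Hence `q → 0`, and
`b̃_A → 0` since `X` and `X⁻¹` are bounded. -/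

noncomputable section

open scoped NNReal

attribute [local instance] Matrix.frobeniusNormedRing Matrix.frobeniusNormedAlgebra

namespace PoseObserver


/-! ### Global solutions of differential equations, bootstrapping and Barbalat-type lemmas. -/

section Analysis

variable {V : Type*} [NormedAddCommGroup V] [NormedSpace ℝ V]

/-- The radial retraction onto the closed ball of radius `r` around the origin. -/
def radialRetract (r : ℝ) (x : V) : V := min 1 (r / ‖x‖) • x

theorem radialRetract_of_norm_le {r : ℝ} {x : V} (h : ‖x‖ ≤ r) : radialRetract r x = x := by
  unfold radialRetract
  rcases eq_or_ne x 0 with rfl | hx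
  · simp
  · rw [min_eq_left, one_smul]
    rwa [one_le_div (norm_pos_iff.2 hx)]

theorem norm_radialRetract {r : ℝ} (hr : 0 ≤ r) (x : V) :
    ‖radialRetract r x‖ = min ‖x‖ r := by
  unfold radialRetract
  rcases eq_or_ne x 0 with rfl | hx
  · simp [hr]
  · have hx' := norm_pos_iff.2 hx
    rw [norm_smul, Real.norm_of_nonneg (by positivity), min_mul_of_nonneg _ _ hx'.le, one_mul,
      div_mul_cancel₀ _ hx'.ne']

/-- For `‖y‖ ≤ ‖x‖`, the difference splits into a contracted copy of `x - y` and a multiple of `y`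
of norm at most `‖x‖ - ‖y‖`. This works in any normed space, at the price of the constant 2 instead
of the 1 of a Hilbert space; the error states carry a maximum norm. -/
theorem lipschitzWith_radialRetract {r : ℝ} (hr : 0 ≤ r) :
    LipschitzWith 2 (radialRetract r : V → V) := by
  have key : ∀ x y : V, ‖y‖ ≤ ‖x‖ → ‖radialRetract r x - radialRetract r y‖ ≤ 2 * ‖x - y‖ := by
    intro x y hyx
    rcases eq_or_ne y 0 with rfl | hy
    · have := norm_radialRetract hr x
      have h0 : radialRetract r (0 : V) = 0 := by simp [radialRetract]
      rw [h0, sub_zero, sub_zero, this]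
      linarith [min_le_left ‖x‖ r, norm_nonneg x]
    have hy' := norm_pos_iff.2 hy
    have hx' : 0 < ‖x‖ := hy'.trans_le hyx
    have hxy : ‖x‖ - ‖y‖ ≤ ‖x - y‖ := norm_sub_norm_le x y
    set sx := min 1 (r / ‖x‖) with hsx
    set sy := min 1 (r / ‖y‖) with hsy
    have hsx0 : 0 ≤ sx := by positivity
    have hsx1 : sx ≤ 1 := min_le_left _ _
    have hle : sx ≤ sy := by
      apply min_le_min le_rfl
      gcongr
    have hdecomp : radialRetract r x - radialRetract r y = sx • (x - y) - (sy - sx) • y := by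
      simp only [radialRetract, ← hsx, ← hsy]
      module
    have hsecond : (sy - sx) * ‖y‖ ≤ ‖x‖ - ‖y‖ := by
      have e1 : sy * ‖y‖ = min ‖y‖ r := by
        rw [hsy, min_mul_of_nonneg _ _ hy'.le, one_mul, div_mul_cancel₀ _ hy'.ne']
      rw [sub_mul, e1]
      rcases le_total ‖x‖ r with h | h
      · have : sx = 1 := by rw [hsx, min_eq_left]; rwa [one_le_div hx']
        rw [this]
        linarith [min_le_left ‖y‖ r]
      · have e2 : sx = r / ‖x‖ := by rw [hsx, min_eq_right]; rwa [div_le_one hx']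
        have e3 : r / ‖x‖ * ‖x‖ = r := div_mul_cancel₀ _ hx'.ne'
        rw [e2]
        have h1 : r / ‖x‖ ≤ 1 := by rwa [div_le_one hx']
        have h2 := min_le_right ‖y‖ r
        nlinarith
    rw [hdecomp]
    calc ‖sx • (x - y) - (sy - sx) • y‖ ≤ ‖sx • (x - y)‖ + ‖(sy - sx) • y‖ := norm_sub_le _ _
      _ = sx * ‖x - y‖ + (sy - sx) * ‖y‖ := by
        rw [norm_smul, norm_smul, Real.norm_of_nonneg hsx0, Real.norm_of_nonneg (by linarith)]
      _ ≤ 1 * ‖x - y‖ + ‖x - y‖ := by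
        gcongr
        linarith
      _ = 2 * ‖x - y‖ := by ring
  refine LipschitzWith.of_dist_le_mul fun x y => ?_
  rw [dist_eq_norm, dist_eq_norm]
  rcases le_total ‖y‖ ‖x‖ with h | h
  · exact key x y h
  · rw [norm_sub_rev, norm_sub_rev x y]
    exact key y x h

/-- A bounded, globally Lipschitz time-dependent vector field has global forward solutions. -/
theorem exists_solution_Ici [CompleteSpace V] {F : ℝ → V → V} {t₀ : ℝ} {K M : ℝ≥0}
    (hLip : ∀ t, t₀ ≤ t → LipschitzWith K (F t))
    (hcont : ∀ x, ContinuousOn (F · x) (Ici t₀))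
    (hbd : ∀ t, t₀ ≤ t → ∀ x, ‖F t x‖ ≤ M) (x₀ : V) :
    ∃ α : ℝ → V, α t₀ = x₀ ∧
      ∀ t ∈ Ici t₀, HasDerivWithinAt α (F t (α t)) (Ici t₀) t := by
  have hex : ∀ n : ℕ, ∃ α : ℝ → V, α t₀ = x₀ ∧ ∀ t ∈ Icc t₀ (t₀ + n),
      HasDerivWithinAt α (F t (α t)) (Icc t₀ (t₀ + n)) t := by
    intro n
    have hmem : t₀ ∈ Icc t₀ (t₀ + n) := ⟨le_rfl, by simp⟩
    -- A field bounded by `M` moves the state by at most `M * n` in time `n`, so the ball of that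
    -- radius is never left.
    have hPL : IsPicardLindelof F (⟨t₀, hmem⟩ : Icc t₀ (t₀ + n)) x₀ (M * n) 0 M K :=
      { lipschitzOnWith := fun t ht => (hLip t ht.1).lipschitzOnWith
        continuousOn := fun x _ => (hcont x).mono Icc_subset_Ici_self
        norm_le := fun t ht x _ => hbd t ht.1 x
        mul_max_le := by simp }
    exact hPL.exists_eq_forall_mem_Icc_hasDerivWithinAt₀
  choose α hα0 hα using hex
  have hIci : ∀ (n : ℕ), ∀ t ∈ Ico t₀ (t₀ + n),
      HasDerivWithinAt (α n) (F t (α n t)) (Ici t) t := by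
    intro n t ht
    refine ((hα n t ⟨ht.1, ht.2.le⟩).mono (Icc_subset_Icc_left ht.1)).mono_of_mem_nhdsWithin ?_
    exact Icc_mem_nhdsGE ht.2
  have hmono : ∀ m n : ℕ, m ≤ n → EqOn (α m) (α n) (Icc t₀ (t₀ + m)) := by
    intro m n hmn
    have hmn' : t₀ + (m : ℝ) ≤ t₀ + n := by gcongr
    refine ODE_solution_unique_of_mem_Icc_right (v := F) (s := fun _ => univ) (K := K)
      (fun t ht => (hLip t ht.1).lipschitzOnWith)
      (fun t ht => (hα m t ht).continuousWithinAt) (hIci m) (fun _ _ => mem_univ _)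
      (fun t ht => ((hα n t ⟨ht.1, ht.2.trans hmn'⟩).continuousWithinAt).mono
        (Icc_subset_Icc_right hmn'))
      (fun t ht => hIci n t ⟨ht.1, ht.2.trans_le hmn'⟩) (fun _ _ => mem_univ _) ?_
    rw [hα0, hα0]
  have hagree : ∀ m n : ℕ, ∀ t ∈ Icc t₀ (t₀ + m), t ∈ Icc t₀ (t₀ + n) → α m t = α n t := by
    intro m n t hm hn
    rcases le_total m n with h | h
    · exact hmono m n h hm
    · exact (hmono n m h hn).symm
  -- The solutions on growing intervals agree, so at time `t` any index at least `t - t₀` may be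
  -- used.
  let β : ℝ → V := fun t => α ⌈t - t₀⌉₊ t
  have hβ : ∀ n : ℕ, EqOn β (α n) (Icc t₀ (t₀ + n)) := by
    intro n t ht
    refine hagree _ _ t ⟨ht.1, ?_⟩ ht
    linarith [Nat.le_ceil (t - t₀)]
  refine ⟨β, ?_, fun t ht => ?_⟩
  · rw [hβ 0 (by simp)]
    exact hα0 0
  · obtain ⟨n, hn⟩ := exists_nat_gt (t - t₀)
    have htn : t < t₀ + n := by linarith
    have htmem : t ∈ Icc t₀ (t₀ + n) := ⟨ht, htn.le⟩
    have h1 := (hα n t htmem).congr (hβ n) (hβ n htmem)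
    rw [← hβ n htmem] at h1
    refine h1.mono_of_mem_nhdsWithin ?_
    rw [mem_nhdsWithin]
    exact ⟨Iio (t₀ + n), isOpen_Iio, htn, fun s hs => ⟨hs.2, hs.1.le⟩⟩

/-- A parametrized vector field that is Lipschitz and bounded on a closed ball has curves, defined
for all future times, that solve the equation as long as they stay in the ball. -/
theorem exists_solution_of_lipschitzOnWith [CompleteSpace V] {P : Type*} [PseudoMetricSpace P]
    {G : P → V → V} {S : Set P} {p : ℝ → P} {c : V} {r t₀ : ℝ} {K M : ℝ≥0} (hr : 0 ≤ r)
    (hG : LipschitzOnWith K (fun q : P × V => G q.1 q.2) (S ×ˢ Metric.closedBall c r))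
    (hM : ∀ q ∈ S, ∀ x, dist x c ≤ r → ‖G q x‖ ≤ M)
    (hp : ContinuousOn p (Ici t₀)) (hpS : ∀ t, t₀ ≤ t → p t ∈ S) (x₀ : V) :
    ∃ α : ℝ → V, α t₀ = x₀ ∧ ContinuousOn α (Ici t₀) ∧ ∀ t ∈ Ici t₀, dist (α t) c ≤ r →
      HasDerivWithinAt α (G (p t) (α t)) (Ici t₀) t := by
  -- Precomposing with the retraction onto the ball makes the field globally Lipschitz and bounded,
  -- and does not change it in the ball.
  let π : V → V := fun x => c + radialRetract r (x - c)
  have hπ_mem : ∀ x, dist (π x) c ≤ r := by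
    intro x
    rw [dist_eq_norm, add_sub_cancel_left, norm_radialRetract hr]
    exact min_le_right _ _
  have hπ_eq : ∀ x, dist x c ≤ r → π x = x := by
    intro x hx
    simp only [π]
    rw [radialRetract_of_norm_le (by rwa [← dist_eq_norm]), add_sub_cancel]
  have hπ_lip : LipschitzWith 2 π := by
    refine LipschitzWith.of_dist_le_mul fun x y => ?_
    rw [dist_add_left]
    refine ((lipschitzWith_radialRetract hr).dist_le_mul _ _).trans ?_
    rw [dist_sub_right]
  have hFlip : ∀ t, t₀ ≤ t → LipschitzWith (K * 2) (fun x => G (p t) (π x)) := by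
    intro t ht
    refine LipschitzWith.of_dist_le_mul fun x y => ?_
    have h1 := hG.dist_le_mul (p t, π x) ⟨hpS t ht, hπ_mem x⟩ (p t, π y) ⟨hpS t ht, hπ_mem y⟩
    have h2 : dist (p t, π x) (p t, π y) = dist (π x) (π y) := by
      rw [Prod.dist_eq, dist_self, max_eq_right dist_nonneg]
    rw [h2] at h1
    have h3 := hπ_lip.dist_le_mul x y
    rw [NNReal.coe_mul, mul_assoc]
    exact h1.trans (by gcongr)
  have hFcont : ∀ x, ContinuousOn (fun t => G (p t) (π x)) (Ici t₀) := fun x =>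
    hG.continuousOn.comp (hp.prodMk continuousOn_const) fun t ht => ⟨hpS t ht, hπ_mem x⟩
  obtain ⟨α, hα0, hα⟩ := exists_solution_Ici hFlip hFcont
    (fun t ht x => hM (p t) (hpS t ht) _ (hπ_mem x)) x₀
  refine ⟨α, hα0, fun t ht => (hα t ht).continuousWithinAt, fun t ht hd => ?_⟩
  have := hα t ht
  rwa [hπ_eq _ hd] at this

/-- A continuous function cannot reach a level that it avoids whenever it stayed below it so far. -/
theorem forall_lt_of_bootstrap {φ : ℝ → ℝ} {t₀ T r : ℝ} (hφ : ContinuousOn φ (Icc t₀ T))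
    (h0 : φ t₀ < r)
    (h : ∀ s ∈ Icc t₀ T, (∀ u ∈ Icc t₀ s, φ u ≤ r) → φ s < r) :
    ∀ t ∈ Icc t₀ T, φ t < r := by
  by_contra! hcon
  obtain ⟨t, ht, hrt⟩ := hcon
  have hcomp : IsCompact (Icc t₀ T ∩ φ ⁻¹' Ici r) :=
    isCompact_Icc.of_isClosed_subset (hφ.preimage_isClosed_of_isClosed isClosed_Icc isClosed_Ici)
      inter_subset_left
  -- The first time at which the level is reached; a value above `r` before it would yield an
  -- earlier crossing.
  obtain ⟨s, hs, hmin⟩ := hcomp.exists_isLeast ⟨t, ht, hrt⟩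
  have hlt : ∀ u ∈ Icc t₀ s, φ u ≤ r := by
    intro u hu
    by_contra! hru
    have hsub : Icc t₀ u ⊆ Icc t₀ T := Icc_subset_Icc_right (hu.2.trans hs.1.2)
    obtain ⟨w, hw, hwr⟩ := intermediate_value_Icc hu.1 (hφ.mono hsub) ⟨h0.le, hru.le⟩
    have hsw : s ≤ w := hmin ⟨hsub hw, hwr.ge⟩
    have : w = u := le_antisymm hw.2 (hu.2.trans hsw)
    rw [this] at hwr
    exact hru.ne' hwr
  exact absurd (h s hs.1 hlt) (not_lt.2 hs.2)

theorem sub_le_of_hasDerivWithinAt_le {f f' : ℝ → ℝ} {a b m : ℝ} (hab : a ≤ b)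
    (hf : ∀ t ∈ Icc a b, HasDerivWithinAt f (f' t) (Icc a b) t)
    (hm : ∀ t ∈ Icc a b, f' t ≤ m) : f b - f a ≤ m * (b - a) := by
  have hder : ∀ t ∈ interior (Icc a b), HasDerivAt f (f' t) t := by
    intro t ht
    exact (hf t (interior_subset ht)).hasDerivAt (mem_interior_iff_mem_nhds.1 ht)
  refine (convex_Icc a b).image_sub_le_mul_sub_of_deriv_le
    (fun t ht => (hf t ht).continuousWithinAt)
    (fun t ht => (hder t ht).differentiableAt.differentiableWithinAt) (fun t ht => ?_)
    a (left_mem_Icc.2 hab) b (right_mem_Icc.2 hab) hab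
  rw [(hder t ht).deriv]
  exact hm t (interior_subset ht)

/-- If a nonnegative function decreases at rate at least `c g²` with `g` Lipschitz, `g → 0`. -/
theorem tendsto_zero_of_dissipation {f f' g : ℝ → ℝ} {t₀ c K : ℝ} (hc : 0 < c) (hK : 0 ≤ K)
    (hf : ∀ t ∈ Ici t₀, HasDerivWithinAt f (f' t) (Ici t₀) t)
    (hf0 : ∀ t ∈ Ici t₀, 0 ≤ f t) (hg0 : ∀ t ∈ Ici t₀, 0 ≤ g t)
    (hf' : ∀ t ∈ Ici t₀, f' t ≤ -(c * g t ^ 2))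
    (hg : ∀ s t, t₀ ≤ s → s ≤ t → |g t - g s| ≤ K * (t - s)) :
    Tendsto g atTop (𝓝 0) := by
  have hanti : ∀ s t, t₀ ≤ s → s ≤ t → f t ≤ f s := by
    intro s t hs hst
    have := sub_le_of_hasDerivWithinAt_le (m := 0) hst
      (fun u hu => (hf u (hs.trans hu.1)).mono (fun w hw => hs.trans hw.1))
      (fun u hu => (hf' u (hs.trans hu.1)).trans (by
        have := mul_nonneg hc.le (sq_nonneg (g u)); linarith))
    linarith
  have hlim : ∃ l, Tendsto f atTop (𝓝 l) := by
    have hA : Antitone (fun t => f (max t₀ t)) := fun s t hst =>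
      hanti _ _ (le_max_left _ _) (max_le_max le_rfl hst)
    refine ⟨_, (tendsto_atTop_ciInf hA ⟨0, ?_⟩).congr' ?_⟩
    · rintro _ ⟨t, rfl⟩
      exact hf0 _ (mem_Ici.2 (le_max_left _ _))
    · filter_upwards [eventually_ge_atTop t₀] with t ht
      rw [max_eq_right ht]
  obtain ⟨l, hl⟩ := hlim
  rw [Metric.tendsto_atTop']
  intro ε hε
  -- A window so short that `g` cannot fall from `ε` to below `ε / 2` in it; `K + 1` covers `K = 0`.
  set h := ε / (2 * (K + 1)) with hh
  have hhpos : 0 < h := by positivity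
  have hKh : K * h ≤ ε / 2 := by
    have : (K + 1) * h = ε / 2 := by rw [hh]; field_simp
    nlinarith
  -- Since `f` converges, its drop over a window of fixed length tends to 0. If `g t ≥ ε`, that drop
  -- would be at least `c (ε / 2)² h`.
  have hdiff : Tendsto (fun t => f t - f (t + h)) atTop (𝓝 0) := by
    simpa using hl.sub (hl.comp (tendsto_atTop_add_const_right atTop h tendsto_id))
  have hev : ∀ᶠ t in atTop, f t - f (t + h) < c * (ε / 2) ^ 2 * h :=
    hdiff.eventually (gt_mem_nhds (by positivity))
  obtain ⟨T, hT⟩ := (hev.and (eventually_ge_atTop t₀)).exists_forall_of_atTop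
  refine ⟨T, fun t ht => ?_⟩
  obtain ⟨h1, h2⟩ := hT t ht.le
  rw [Real.dist_0_eq_abs, abs_of_nonneg (hg0 t h2)]
  by_contra! hcon
  have hlow : ∀ s ∈ Icc t (t + h), ε / 2 ≤ g s := by
    intro s hs
    have := (abs_le.1 (hg t s h2 hs.1)).1
    have h3 : K * (s - t) ≤ K * h := by gcongr; linarith [hs.2]
    linarith
  have := sub_le_of_hasDerivWithinAt_le (m := -(c * (ε / 2) ^ 2)) (by linarith : t ≤ t + h)
    (fun u hu => (hf u (h2.trans hu.1)).mono (fun w hw => h2.trans hw.1))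
    (fun u hu => (hf' u (h2.trans hu.1)).trans (by
      have := hlow u hu
      gcongr))
  have e : t + h - t = h := by ring
  rw [e] at this
  linarith

/-- If `Z → 0`, `Z' = q + ρ` with `ρ → 0` and `q` is Lipschitz, then `q → 0`. -/
theorem tendsto_zero_of_deriv_lipschitz {Z q ρ : ℝ → V} {t₀ K : ℝ} (hK : 0 ≤ K)
    (hZ : ∀ t ∈ Ici t₀, HasDerivWithinAt Z (q t + ρ t) (Ici t₀) t)
    (hZ0 : Tendsto Z atTop (𝓝 0)) (hρ : Tendsto ρ atTop (𝓝 0))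
    (hq : ∀ s t, t₀ ≤ s → s ≤ t → ‖q t - q s‖ ≤ K * (t - s)) :
    Tendsto q atTop (𝓝 0) := by
  rw [Metric.tendsto_atTop']
  intro ε hε
  set h := ε / (4 * (K + 1)) with hh
  have hhpos : 0 < h := by positivity
  have hKh : K * h ≤ ε / 4 := by
    have : (K + 1) * h = ε / 4 := by rw [hh]; field_simp
    nlinarith
  have hZe : ∀ᶠ t in atTop, ‖Z t‖ < ε * h / 4 :=
    (tendsto_zero_iff_norm_tendsto_zero.1 hZ0).eventually (gt_mem_nhds (by positivity))
  have hρe : ∀ᶠ t in atTop, ‖ρ t‖ < ε / 4 :=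
    (tendsto_zero_iff_norm_tendsto_zero.1 hρ).eventually (gt_mem_nhds (by positivity))
  obtain ⟨T, hT⟩ := ((hZe.and hρe).and (eventually_ge_atTop t₀)).exists_forall_of_atTop
  refine ⟨T, fun t ht => ?_⟩
  rw [dist_zero_right]
  have ht0 : t₀ ≤ t := (hT t ht.le).2
  -- Subtracting the linear motion with frozen velocity `q t` leaves a derivative `(q s - q t) + ρ
  -- s` of norm at most `ε / 2`. As `Z` is small at both ends of the window, `h ‖q t‖` is less than
  -- `ε h / 2 + 2 (ε h / 4) = ε h`.
  have hW : ∀ s ∈ Icc t (t + h), HasDerivWithinAt (fun s => Z s - (s - t) • q t)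
      (q s + ρ s - (1 : ℝ) • q t) (Icc t (t + h)) s := by
    intro s hs
    refine ((hZ s (ht0.trans hs.1)).mono (fun w hw => ht0.trans hw.1)).sub ?_
    exact (((hasDerivAt_id s).sub_const t).smul_const (q t)).hasDerivWithinAt
  have hb := norm_image_sub_le_of_norm_deriv_le_segment' hW (C := ε / 2) (fun s hs => by
    have e : q s + ρ s - (1 : ℝ) • q t = (q s - q t) + ρ s := by module
    rw [e]
    refine (norm_add_le _ _).trans ?_
    have h1 := hq t s ht0 hs.1
    have h2 : K * (s - t) ≤ K * h := by gcongr; linarith [hs.2]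
    have h3 := (hT s (ht.le.trans hs.1)).1.2
    linarith) (t + h) ⟨by linarith, le_rfl⟩
  have e : t + h - t = h := by ring
  simp only [e, sub_self, zero_smul, sub_zero] at hb
  have h1 := (hT t ht.le).1.1
  have h2 := (hT (t + h) (by linarith)).1.1
  have h3 : ‖h • q t‖ ≤ ‖Z (t + h) - h • q t - Z t‖ + ‖Z (t + h)‖ + ‖Z t‖ := by
    have e2 : h • q t = -(Z (t + h) - h • q t - Z t) + Z (t + h) - Z t := by module
    conv_lhs => rw [e2]
    refine (norm_sub_le _ _).trans ?_
    gcongr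
    refine (norm_add_le _ _).trans ?_
    rw [norm_neg]
  rw [norm_smul, Real.norm_of_nonneg hhpos.le] at h3
  have h4 : h * ‖q t‖ < h * ε := by linarith
  exact lt_of_mul_lt_mul_left h4 hhpos.le

end Analysis


/-! ### Algebra of twists, rotations and poses. -/

/-- Each component of `a` occurs twice in the skew block. This factor 2 matches the `1 / 2` in the
definition of `innovOmega`. -/
theorem norm_twist_sq (a c : Vec3) : ‖twist a c‖ ^ 2 = 2 * (a ⬝ᵥ a) + c ⬝ᵥ c := by
  rw [Matrix.frobenius_norm_def, ← Real.sqrt_eq_rpow, Real.sq_sqrt (by positivity)]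
  simp [twist, skew, Fin.sum_univ_three, dotProduct]
  ring

theorem skew_sub (a b : Vec3) : skew (a - b) = skew a - skew b := by
  ext i j
  fin_cases i <;> fin_cases j <;> simp [skew] <;> ring

theorem twist_sub (a b c d : Vec3) : twist a b - twist c d = twist (a - c) (b - d) := by
  ext (i | i) (j | j) <;> simp [twist, skew_sub]

theorem twist_zero : twist 0 0 = 0 := by
  have := twist_sub 0 0 0 0
  simpa using this.symm

/-- Each summand is the rank-one matrix `(y - (e ⬝ y) e) eᵀ`. Its multiple of `e eᵀ` is symmetric
and disappears from the rotation block, where the antisymmetric part of `y eᵀ` gives the cross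
product; the last column is scaled by the fourth component of `e`. -/
theorem innovation_eq_twist {N : ℕ} (yo : Fin N → Vec4) (k : Fin N → ℝ) (Xh : Mat4)
    (Y : Fin N → Vec4) :
    innovation yo k Xh Y = twist (innovOmega yo k Xh Y) (innovV yo k Xh Y) := by
  have h1 : ∀ (e y : Vec4), (1 - Matrix.vecMulVec e e) * Matrix.vecMulVec y e
      = Matrix.vecMulVec (y - (e ⬝ᵥ y) • e) e := by
    intro e y
    rw [sub_mul, one_mul, Matrix.vecMulVec_mul_vecMulVec, Matrix.sub_vecMulVec]
    simp
  simp only [innovation, innovOmega, innovV, h1]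
  ext i j
  rcases i with i | i <;> rcases j with j | j
  · simp only [twist, projSe3, Matrix.neg_apply, Matrix.fromBlocks_apply₁₁, Matrix.smul_apply,
      Matrix.sub_apply, Matrix.transpose_apply, Matrix.toBlocks₁₁, Matrix.of_apply,
      Matrix.sum_apply, Matrix.vecMulVec_apply, smul_eq_mul, ← Finset.sum_sub_distrib]
    fin_cases i <;> fin_cases j <;>
      simp [skew, vecPart, cross_apply] <;>
      simp only [Finset.mul_sum, ← Finset.sum_sub_distrib, ← Finset.sum_neg_distrib] <;>
      exact Finset.sum_congr rfl fun i _ => by ring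
  · simp only [twist, projSe3, Matrix.neg_apply, Matrix.fromBlocks_apply₁₂,
      Matrix.toBlocks₁₂, Matrix.of_apply, Matrix.replicateCol_apply,
      Matrix.sum_apply, Matrix.smul_apply, Matrix.vecMulVec_apply, smul_eq_mul, Finset.sum_apply,
      ← Finset.sum_neg_distrib]
    refine Finset.sum_congr rfl fun i _ => ?_
    simp [vecPart, fourth]
    ring
  · simp [twist, projSe3]
  · simp [twist, projSe3]

theorem twist_mulVec (a c : Vec3) (e : Vec4) :
    twist a c *ᵥ e = Sum.elim (crossProduct a (vecPart e) + fourth e • c) 0 := by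
  ext i
  rcases i with i | i
  · rw [← skew_mulVec]
    simp [twist, Matrix.mulVec, dotProduct, vecPart, fourth, mul_comm]
  · simp [twist, Matrix.mulVec, dotProduct]

theorem dotProduct_twist_mulVec (a c : Vec3) (y e : Vec4) :
    y ⬝ᵥ (twist a c *ᵥ e) =
      a ⬝ᵥ crossProduct (vecPart e) (vecPart y) + fourth e * (c ⬝ᵥ vecPart y) := by
  rw [twist_mulVec]
  simp only [dotProduct, Fintype.sum_sum_type, Sum.elim_inl, Sum.elim_inr, Pi.add_apply,
    Pi.smul_apply, Fin.sum_univ_three]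
  simp [cross_apply, vecPart]
  ring

theorem dotProduct_twist_mulVec_self (a c : Vec3) (e : Vec4) :
    e ⬝ᵥ (twist a c *ᵥ e) = fourth e * (c ⬝ᵥ vecPart e) := by
  rw [dotProduct_twist_mulVec, cross_self, dotProduct_zero, zero_add]

/-- The matrix form of `det (M a, M u, M v) = det M · det (a, u, v)`. For a rotation it says that
conjugating `a_×` by `R` gives `(R a)_×`. -/
theorem transpose_mul_skew_mul (M : Mat3) (a : Vec3) :
    Mᵀ * skew (M *ᵥ a) * M = M.det • skew a := by
  ext i j
  rw [Matrix.det_fin_three]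
  fin_cases i <;> fin_cases j <;>
    simp [skew, Matrix.mul_apply, Matrix.mulVec, dotProduct, Fin.sum_univ_three] <;> ring_nf

theorem mem_SO_iff {R : Mat3} :
    R ∈ Matrix.specialOrthogonalGroup (Fin 3) ℝ ↔ Rᵀ * R = 1 ∧ R.det = 1 := by
  rw [Matrix.mem_specialOrthogonalGroup_iff, Matrix.mem_orthogonalGroup_iff']

theorem skew_mul_of_mem_SO {R : Mat3} (hR : R ∈ Matrix.specialOrthogonalGroup (Fin 3) ℝ)
    (a : Vec3) : skew (R *ᵥ a) * R = R * skew a := by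
  obtain ⟨h1, h2⟩ := mem_SO_iff.1 hR
  have h3 : R * Rᵀ = 1 := mul_eq_one_comm.1 h1
  have := transpose_mul_skew_mul R a
  rw [h2, one_smul] at this
  rw [← this, mul_assoc, ← mul_assoc, h3, one_mul]

theorem rotPart_pose (R : Mat3) (p : Vec3) : rotPart (pose R p) = R := by
  simp [rotPart, pose]

theorem posPart_pose (R : Mat3) (p : Vec3) : posPart (pose R p) = p := by
  ext i
  simp [posPart, pose]

theorem pose_mul_pose (R R' : Mat3) (p p' : Vec3) :
    pose R p * pose R' p' = pose (R * R') (R *ᵥ p' + p) := by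
  unfold pose
  rw [Matrix.fromBlocks_multiply]
  congr 1
  · simp
  · ext i j
    simp [Matrix.mul_apply, Matrix.mulVec, dotProduct]
  · simp
  · simp

theorem pose_one_zero : pose 1 0 = 1 := by
  unfold pose
  rw [← Matrix.fromBlocks_one]
  rfl

theorem mul_mem_SE3 {X Y : Mat4} (hX : X ∈ SE3) (hY : Y ∈ SE3) : X * Y ∈ SE3 := by
  obtain ⟨R, hR, p, rfl⟩ := hX
  obtain ⟨R', hR', p', rfl⟩ := hY
  exact ⟨R * R', mul_mem hR hR', _, pose_mul_pose R R' p p'⟩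

theorem one_mem_SE3 : (1 : Mat4) ∈ SE3 := ⟨1, one_mem _, 0, pose_one_zero.symm⟩

theorem exists_inv_mem_SE3 {X : Mat4} (hX : X ∈ SE3) : ∃ Y ∈ SE3, Y * X = 1 := by
  obtain ⟨R, hR, p, rfl⟩ := hX
  obtain ⟨h1, h2⟩ := mem_SO_iff.1 hR
  refine ⟨pose Rᵀ (-(Rᵀ *ᵥ p)), ⟨Rᵀ, ?_, _, rfl⟩, ?_⟩
  · rw [mem_SO_iff, Matrix.transpose_transpose, Matrix.det_transpose]
    exact ⟨mul_eq_one_comm.1 h1, h2⟩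
  · rw [pose_mul_pose, h1]
    simp [pose_one_zero]

theorem inv_mem_SE3 {X : Mat4} (hX : X ∈ SE3) : X⁻¹ ∈ SE3 := by
  obtain ⟨Y, hY, h⟩ := exists_inv_mem_SE3 hX
  rwa [Matrix.inv_eq_left_inv h]

theorem isUnit_of_mem_SE3 {X : Mat4} (hX : X ∈ SE3) : IsUnit X := by
  obtain ⟨Y, -, h⟩ := exists_inv_mem_SE3 hX
  exact IsUnit.of_mul_eq_one Y (mul_eq_one_comm.1 h)

theorem mul_inv_of_mem_SE3 {X : Mat4} (hX : X ∈ SE3) : X * X⁻¹ = 1 :=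
  Matrix.mul_nonsing_inv _ ((Matrix.isUnit_iff_isUnit_det _).1 (isUnit_of_mem_SE3 hX))

theorem inv_mul_of_mem_SE3 {X : Mat4} (hX : X ∈ SE3) : X⁻¹ * X = 1 :=
  Matrix.nonsing_inv_mul _ ((Matrix.isUnit_iff_isUnit_det _).1 (isUnit_of_mem_SE3 hX))

/-- The adjoint action of a pose on a twist. -/
theorem mul_twist_of_mem_SE3 {X : Mat4} (hX : X ∈ SE3) (a c : Vec3) :
    X * twist a c = twist (rotPart X *ᵥ a)
      (rotPart X *ᵥ c - crossProduct (rotPart X *ᵥ a) (posPart X)) * X := by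
  obtain ⟨R, hR, p, rfl⟩ := hX
  rw [rotPart_pose, posPart_pose, ← skew_mulVec]
  unfold pose twist
  rw [Matrix.fromBlocks_multiply, Matrix.fromBlocks_multiply]
  congr 1
  · simp [skew_mul_of_mem_SO hR]
  · ext i j
    simp [Matrix.mul_apply, Matrix.mulVec, dotProduct]
  · simp
  · simp

/-! ### Euclidean norm, output errors and saturation. -/

section Normalize

variable {ι : Type*} [Fintype ι]

theorem dotProduct_self_nonneg' (v : ι → ℝ) : 0 ≤ v ⬝ᵥ v :=
  Finset.sum_nonneg fun _ _ => mul_self_nonneg _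

theorem eNorm_nonneg (v : ι → ℝ) : 0 ≤ eNorm v := Real.sqrt_nonneg _

theorem eNorm_sq (v : ι → ℝ) : eNorm v ^ 2 = v ⬝ᵥ v := Real.sq_sqrt (dotProduct_self_nonneg' v)

theorem eNorm_pos {v : ι → ℝ} (hv : v ≠ 0) : 0 < eNorm v :=
  Real.sqrt_pos.2 ((dotProduct_self_nonneg' v).lt_of_ne' fun h => hv (dotProduct_self_eq_zero.1 h))

theorem eNorm_eq_norm (v : ι → ℝ) : eNorm v = ‖WithLp.toLp 2 v‖ := by
  rw [eNorm, EuclideanSpace.norm_eq]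
  simp [dotProduct, sq]

theorem dotProduct_le_eNorm_mul (u v : ι → ℝ) : u ⬝ᵥ v ≤ eNorm u * eNorm v := by
  have h := real_inner_le_norm (WithLp.toLp 2 v) (WithLp.toLp 2 u)
  rw [EuclideanSpace.inner_toLp_toLp] at h
  rw [eNorm_eq_norm, eNorm_eq_norm, mul_comm]
  simpa using h

theorem eNorm_smul (c : ℝ) (v : ι → ℝ) : eNorm (c • v) = |c| * eNorm v := by
  rw [eNorm_eq_norm, eNorm_eq_norm, WithLp.toLp_smul, norm_smul, Real.norm_eq_abs]

theorem normalize_smul {c : ℝ} (hc : 0 < c) (v : ι → ℝ) : normalize (c • v) = normalize v := by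
  unfold normalize
  rw [eNorm_smul, abs_of_pos hc, smul_smul]
  congr 1
  field_simp

theorem normalize_dotProduct_self {v : ι → ℝ} (hv : v ≠ 0) :
    normalize v ⬝ᵥ normalize v = 1 := by
  have h := eNorm_pos hv
  simp only [normalize, smul_dotProduct, dotProduct_smul, ← eNorm_sq, smul_eq_mul]
  field_simp

theorem normalize_of_eNorm_eq_one {v : ι → ℝ} (hv : eNorm v = 1) : normalize v = v := by
  simp [normalize, hv]

theorem ne_zero_of_eNorm_eq_one {v : ι → ℝ} (hv : eNorm v = 1) : v ≠ 0 := by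
  rintro rfl
  simp [eNorm] at hv

end Normalize

theorem mulVec_ne_zero_of_mem_SE3 {E : Mat4} (hE : E ∈ SE3) {y : Vec4} (hy : y ≠ 0) :
    E *ᵥ y ≠ 0 := by
  intro h
  apply hy
  rw [← Matrix.one_mulVec y, ← inv_mul_of_mem_SE3 hE, ← Matrix.mulVec_mulVec, h,
    Matrix.mulVec_zero]

/-- Normalization ignores positive factors, so the measured output enters only through `Xh * X⁻¹`.
This makes the innovation a function of the pose error alone. -/
theorem outErr_output {X : Mat4} (hX : X ∈ SE3) (Xh : Mat4) {y : Vec4} (hy : y ≠ 0) :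
    outErr Xh (output X y) = outErr (Xh * X⁻¹) y := by
  have h := eNorm_pos (mulVec_ne_zero_of_mem_SE3 (inv_mem_SE3 hX) hy)
  change normalize (Xh *ᵥ ((eNorm (X⁻¹ *ᵥ y))⁻¹ • (X⁻¹ *ᵥ y))) = _
  rw [Matrix.mulVec_smul, normalize_smul (inv_pos.2 h), Matrix.mulVec_mulVec, outErr]

theorem outErr_one {y : Vec4} (hy : eNorm y = 1) : outErr 1 y = y := by
  rw [outErr, Matrix.one_mulVec, normalize_of_eNorm_eq_one hy]

section Innovation

variable {N : ℕ} {yo : Fin N → Vec4} (k : Fin N → ℝ)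

theorem innovOmega_output (hyo : ∀ i, yo i ≠ 0) {X : Mat4} (hX : X ∈ SE3) (Xh : Mat4) :
    innovOmega yo k Xh (fun i => output X (yo i)) = innovOmega yo k (Xh * X⁻¹) yo := by
  simp only [innovOmega, outErr_output hX Xh (hyo _)]

theorem innovV_output (hyo : ∀ i, yo i ≠ 0) {X : Mat4} (hX : X ∈ SE3) (Xh : Mat4) :
    innovV yo k Xh (fun i => output X (yo i)) = innovV yo k (Xh * X⁻¹) yo := by
  simp only [innovV, outErr_output hX Xh (hyo _)]

theorem innovOmega_one (hyo : ∀ i, eNorm (yo i) = 1) : innovOmega yo k 1 yo = 0 := by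
  simp [innovOmega, outErr_one (hyo _)]

theorem innovV_one (hyo : ∀ i, eNorm (yo i) = 1) : innovV yo k 1 yo = 0 := by
  simp [innovV, outErr_one (hyo _), ← eNorm_sq, hyo]

end Innovation

theorem sat_of_eNorm_le {δ : ℝ} {x : Vec3} (h : eNorm x ≤ δ) : sat δ x = x := by
  have := radialRetract_of_norm_le (V := EuclideanSpace ℝ (Fin 3)) (x := WithLp.toLp 2 x)
    (r := δ) (by rwa [← eNorm_eq_norm])
  rw [radialRetract, ← eNorm_eq_norm] at this
  exact congrArg WithLp.ofLp this

theorem sat_eq_radialRetract (δ : ℝ) (x : Vec3) :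
    sat δ x = WithLp.ofLp (radialRetract δ (WithLp.toLp 2 x)) := by
  rw [radialRetract, ← eNorm_eq_norm]
  rfl

theorem exists_lipschitzWith_sat {δ : ℝ} (hδ : 0 ≤ δ) : ∃ K, LipschitzWith K (sat δ) := by
  have h := ((PiLp.lipschitzWith_ofLp 2 fun _ : Fin 3 => ℝ).comp
    (lipschitzWith_radialRetract hδ)).comp (PiLp.lipschitzWith_toLp 2 fun _ : Fin 3 => ℝ)
  have e : sat δ = (WithLp.ofLp ∘ radialRetract δ) ∘ WithLp.toLp 2 :=
    funext fun x => sat_eq_radialRetract δ x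
  exact ⟨_, e ▸ h⟩

/-- The anti-windup term does not increase the bias error. -/
theorem dotProduct_sub_sat_nonpos {δ : ℝ} {b : Vec3} (hb : eNorm b ≤ δ) (x : Vec3) :
    (b - x) ⬝ᵥ (x - sat δ x) ≤ 0 := by
  rcases le_or_gt (eNorm x) δ with h | h
  · simp [sat_of_eNorm_le h]
  · have hx : 0 < eNorm x := ((eNorm_nonneg b).trans hb).trans_lt h
    have hs : min 1 (δ / eNorm x) ≤ 1 := min_le_left _ _
    have e : x - sat δ x = (1 - min 1 (δ / eNorm x)) • x := by
      unfold sat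
      module
    rw [e, dotProduct_smul, smul_eq_mul]
    -- Outside the ball, `b ⬝ x ≤ |b| |x| ≤ δ |x| < |x|²` by Cauchy–Schwarz.
    apply mul_nonpos_of_nonneg_of_nonpos (by linarith)
    rw [sub_dotProduct, ← eNorm_sq]
    have := dotProduct_le_eNorm_mul b x
    nlinarith


/-! ### Derivatives of matrix expressions and of output errors. -/

section Derivatives

theorem HasDerivWithinAt.dotProduct_fun {ι : Type*} [Fintype ι] {u v : ℝ → ι → ℝ} {u' v' : ι → ℝ}
    {J : Set ℝ} {t : ℝ} (hu : HasDerivWithinAt u u' J t) (hv : HasDerivWithinAt v v' J t) :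
    HasDerivWithinAt (fun s => u s ⬝ᵥ v s) (u' ⬝ᵥ v t + u t ⬝ᵥ v') J t := by
  simp only [dotProduct, ← Finset.sum_add_distrib]
  exact HasDerivWithinAt.fun_sum fun i _ =>
    (hasDerivWithinAt_pi.1 hu i).mul (hasDerivWithinAt_pi.1 hv i)

theorem HasDerivWithinAt.matrix_mulVec_const {m n : Type*} [Fintype m] [Fintype n]
    {M : ℝ → Matrix m n ℝ} {M' : Matrix m n ℝ} {J : Set ℝ} {t : ℝ}
    (hM : HasDerivWithinAt M M' J t) (y : n → ℝ) :
    HasDerivWithinAt (fun s => M s *ᵥ y) (M' *ᵥ y) J t := by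
  let L : Matrix m n ℝ →ₗ[ℝ] (m → ℝ) := (Matrix.mulVecBilin ℝ ℝ).flip y
  exact (LinearMap.toContinuousLinearMap L).hasFDerivAt.comp_hasDerivWithinAt t hM

theorem HasDerivWithinAt.matrix_entry {m n : Type*} [Fintype m] [Fintype n]
    {M : ℝ → Matrix m n ℝ} {M' : Matrix m n ℝ} {J : Set ℝ} {t : ℝ}
    (hM : HasDerivWithinAt M M' J t) (i : m) (j : n) :
    HasDerivWithinAt (fun s => M s i j) (M' i j) J t :=
  (LinearMap.toContinuousLinearMap
    (Matrix.entryLinearMap ℝ ℝ i j)).hasFDerivAt.comp_hasDerivWithinAt t hM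

theorem HasDerivWithinAt.matrix_inv {n : Type*} [Fintype n] [DecidableEq n]
    {M : ℝ → Matrix n n ℝ} {M' : Matrix n n ℝ} {J : Set ℝ} {t : ℝ}
    (hM : HasDerivWithinAt M M' J t) (hu : IsUnit (M t)) :
    HasDerivWithinAt (fun s => (M s)⁻¹) (-((M t)⁻¹ * M' * (M t)⁻¹)) J t := by
  obtain ⟨u, hu⟩ := hu
  have h1 := hasFDerivAt_ringInverse (𝕜 := ℝ) u
  rw [hu] at h1
  simp only [Matrix.nonsing_inv_eq_ringInverse]
  refine (h1.comp_hasDerivWithinAt t hM).congr_deriv ?_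
  rw [← hu]
  simp

theorem HasDerivWithinAt.fst_fun {V W : Type*} [NormedAddCommGroup V] [NormedSpace ℝ V]
    [NormedAddCommGroup W] [NormedSpace ℝ W] {f : ℝ → V × W} {f' : V × W} {J : Set ℝ} {t : ℝ}
    (hf : HasDerivWithinAt f f' J t) : HasDerivWithinAt (fun s => (f s).1) f'.1 J t :=
  (ContinuousLinearMap.fst ℝ V W).hasFDerivAt.comp_hasDerivWithinAt t hf

theorem HasDerivWithinAt.snd_fun {V W : Type*} [NormedAddCommGroup V] [NormedSpace ℝ V]
    [NormedAddCommGroup W] [NormedSpace ℝ W] {f : ℝ → V × W} {f' : V × W} {J : Set ℝ} {t : ℝ}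
    (hf : HasDerivWithinAt f f' J t) : HasDerivWithinAt (fun s => (f s).2) f'.2 J t :=
  (ContinuousLinearMap.snd ℝ V W).hasFDerivAt.comp_hasDerivWithinAt t hf

/-- The derivative of the correlation `e ⬝ y` of an output error along `E' = U E`. -/
theorem hasDerivWithinAt_outErr_dotProduct {E : ℝ → Mat4} {U : Mat4} {J : Set ℝ} {t : ℝ}
    {y : Vec4} (hE : HasDerivWithinAt E (U * E t) J t) (hy : E t *ᵥ y ≠ 0) :
    HasDerivWithinAt (fun s => outErr (E s) y ⬝ᵥ y)
      (y ⬝ᵥ (U *ᵥ outErr (E t) y) -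
        (outErr (E t) y ⬝ᵥ y) * (outErr (E t) y ⬝ᵥ (U *ᵥ outErr (E t) y))) J t := by
  have hw := HasDerivWithinAt.matrix_mulVec_const hE y
  have hww := HasDerivWithinAt.dotProduct_fun hw hw
  have hwy := HasDerivWithinAt.dotProduct_fun hw (hasDerivWithinAt_const t J y)
  have hpos : 0 < (E t *ᵥ y) ⬝ᵥ (E t *ᵥ y) :=
    (dotProduct_self_nonneg' _).lt_of_ne' fun h => hy (dotProduct_self_eq_zero.1 h)
  have hn := (hww.sqrt hpos.ne').inv (Real.sqrt_pos.2 hpos).ne'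
  have e : (fun s => outErr (E s) y ⬝ᵥ y) =
      fun s => (√((E s *ᵥ y) ⬝ᵥ (E s *ᵥ y)))⁻¹ * ((E s *ᵥ y) ⬝ᵥ y) := by
    funext s
    simp [outErr, normalize, eNorm]
  rw [e]
  refine (hn.mul hwy).congr_deriv ?_
  have e2 : outErr (E t) y = (√((E t *ᵥ y) ⬝ᵥ (E t *ᵥ y)))⁻¹ • (E t *ᵥ y) := rfl
  rw [e2, ← Matrix.mulVec_mulVec, Pi.inv_apply]
  set w := E t *ᵥ y
  have hpos' := Real.sqrt_pos.2 hpos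
  set n := √(w ⬝ᵥ w)
  simp only [Matrix.mulVec_smul, dotProduct_smul, smul_dotProduct, dotProduct_zero, smul_eq_mul]
  rw [dotProduct_comm (U *ᵥ w) w, dotProduct_comm (U *ᵥ w) y]
  field_simp
  ring

end Derivatives

/-! ### The error dynamics and the Lyapunov function. -/

variable {N : ℕ} (yo : Fin N → Vec4) (k : Fin N → ℝ)

/-- The total misalignment `∑ kᵢ (1 - eᵢ ⬝ ẙᵢ)` of the output errors. -/
def misalignment (E : Mat4) : ℝ := ∑ i, k i * (1 - outErr E (yo i) ⬝ᵥ yo i)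

/-- The right-hand side is the Frobenius product of `twist a c` with the innovation: the innovation
is the gradient of the misalignment. -/
theorem hasDerivWithinAt_misalignment {yo} {E : ℝ → Mat4} {a c : Vec3} {J : Set ℝ} {t : ℝ}
    (hE : HasDerivWithinAt E (twist a c * E t) J t) (hy : ∀ i, E t *ᵥ yo i ≠ 0) :
    HasDerivWithinAt (fun s => misalignment yo k (E s))
      (2 * (a ⬝ᵥ innovOmega yo k (E t) yo) + c ⬝ᵥ innovV yo k (E t) yo) J t := by
  have h := HasDerivWithinAt.fun_sum (u := Finset.univ) fun i _ =>
    ((hasDerivWithinAt_outErr_dotProduct hE (hy i)).const_sub 1).const_mul (k i)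
  refine h.congr_deriv ?_
  simp only [innovOmega, innovV, dotProduct_neg, dotProduct_smul, dotProduct_sum,
    dotProduct_twist_mulVec, cross_self, dotProduct_zero, dotProduct_sub, smul_eq_mul]
  rw [mul_neg, ← mul_assoc, Finset.mul_sum, ← Finset.sum_neg_distrib, ← Finset.sum_add_distrib]
  refine Finset.sum_congr rfl fun i _ => ?_
  ring

/-- The state `(E, b_Ω - bh_Ω, b_V - bh_V)` of the error dynamics. -/
abbrev ErrState := Mat4 × Vec3 × Vec3

/-- The left velocity `U` of the pose error, `E' = U E`. -/
def errVelocity (Xh : Mat4) (z : ErrState) : Mat4 :=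
  twist (rotPart Xh *ᵥ z.2.1 - innovOmega yo k z.1 yo)
    (rotPart Xh *ᵥ z.2.2 - crossProduct (rotPart Xh *ᵥ z.2.1) (posPart Xh) - innovV yo k z.1 yo)

/-- The part of the bias error field coming from the innovation. -/
def biasField (kb : ℝ) (Xh E : Mat4) : Vec3 × Vec3 :=
  (kb • ((rotPart Xh)ᵀ *ᵥ (innovOmega yo k E yo +
      (1 / 2 : ℝ) • crossProduct (innovV yo k E yo) (posPart Xh))),
    kb • ((rotPart Xh)ᵀ *ᵥ innovV yo k E yo))

/-- The vector field of the error dynamics at a time where the true pose is `X`. -/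
def errField (kb κΩ κV δΩ δV : ℝ) (bΩ bV : Vec3) (X : Mat4) (z : ErrState) : ErrState :=
  (errVelocity yo k (z.1 * X) z * z.1,
    κΩ • ((bΩ - z.2.1) - sat δΩ (bΩ - z.2.1)) - (biasField yo k kb (z.1 * X) z.1).1,
    κV • ((bV - z.2.2) - sat δV (bV - z.2.2)) - (biasField yo k kb (z.1 * X) z.1).2)

/-- Solutions of the error dynamics in `SE(3) × ℝ³ × ℝ³`. -/
def IsErrSolution (kb κΩ κV δΩ δV : ℝ) (bΩ bV : Vec3) (X : ℝ → Mat4) (J : Set ℝ)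
    (z : ℝ → ErrState) : Prop :=
  ∀ t ∈ J, (z t).1 ∈ SE3 ∧
    HasDerivWithinAt z (errField yo k kb κΩ κV δΩ δV bΩ bV (X t) (z t)) J t

variable {yo} {k} {kb κΩ κV δΩ δV : ℝ} {bΩ bV : Vec3} {A X : ℝ → Mat4} {J : Set ℝ}

/-- The observer carries the bias error as a right velocity; the adjoint action moves it to the
left, where the innovation already stands. -/
theorem errVelocity_mul {Xh : Mat4} (hXh : Xh ∈ SE3) (z : ErrState) :
    errVelocity yo k Xh z * Xh =
      Xh * twist z.2.1 z.2.2 - innovation yo k z.1 yo * Xh := by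
  rw [mul_twist_of_mem_SE3 hXh, innovation_eq_twist, ← sub_mul, twist_sub]
  rfl

/-- In the product rule for `Xh * X⁻¹` the terms containing `A` cancel, which leaves the bias error
and the innovation. -/
theorem IsErrorMotion.exists_isErrSolution (hyo : ∀ i, yo i ≠ 0)
    (hX_mem : ∀ t ∈ J, X t ∈ SE3) (hX_ode : ∀ t ∈ J, HasDerivWithinAt X (X t * A t) J t)
    {x : ℝ → Mat4 × Mat4} (hx : IsErrorMotion yo k kb κΩ κV δΩ δV A X bΩ bV J x) :
    ∃ z : ℝ → ErrState, IsErrSolution yo k kb κΩ κV δΩ δV bΩ bV X J z ∧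
      ∀ t ∈ J, x t = ((z t).1, twist (z t).2.1 (z t).2.2) := by
  obtain ⟨Xh, bhΩ, bhV, h, hx⟩ := hx
  refine ⟨fun t => (Xh t * (X t)⁻¹, bΩ - bhΩ t, bV - bhV t), fun t ht => ?_, fun t ht => ?_⟩
  · have hXt := hX_mem t ht
    have hXh := h.mem_SE3 t ht
    have hcancel : Xh t * (X t)⁻¹ * X t = Xh t := by
      rw [mul_assoc, inv_mul_of_mem_SE3 hXt, mul_one]
    refine ⟨mul_mem_SE3 hXh (inv_mem_SE3 hXt), ?_⟩
    have hinv := HasDerivWithinAt.matrix_inv (hX_ode t ht) (isUnit_of_mem_SE3 hXt)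
    have hE := (h.deriv_pose t ht).mul hinv
    have hΩ := (h.deriv_biasΩ t ht).const_sub bΩ
    have hV := (h.deriv_biasV t ht).const_sub bV
    have hz := hE.prodMk (hΩ.prodMk hV)
    refine hz.congr_deriv ?_
    simp only [errField, biasField, hcancel, innovOmega_output k hyo hXt, innovV_output k hyo hXt,
      sub_sub_cancel, neg_sub]
    congr 1
    rw [← mul_assoc (errVelocity _ _ _ _), errVelocity_mul hXh, innovation_eq_twist,
      innovation_eq_twist, innovOmega_output k hyo hXt, innovV_output k hyo hXt, ← mul_assoc (X t)⁻¹,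
      inv_mul_of_mem_SE3 hXt, one_mul, ← twist_sub]
    noncomm_ring
  · rw [hx t ht, twist_sub]

/-- The estimates are recovered as `Xh = E * X` and `bh = b - b̃`. -/
theorem IsErrSolution.isErrorMotion (hyo : ∀ i, yo i ≠ 0)
    (hX_mem : ∀ t ∈ J, X t ∈ SE3) (hX_ode : ∀ t ∈ J, HasDerivWithinAt X (X t * A t) J t)
    {z : ℝ → ErrState} (hz : IsErrSolution yo k kb κΩ κV δΩ δV bΩ bV X J z) :
    IsErrorMotion yo k kb κΩ κV δΩ δV A X bΩ bV J
      (fun t => ((z t).1, twist (z t).2.1 (z t).2.2)) := by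
  have hcancel : ∀ t ∈ J, (z t).1 * X t * (X t)⁻¹ = (z t).1 := fun t ht => by
    rw [mul_assoc, mul_inv_of_mem_SE3 (hX_mem t ht), mul_one]
  refine ⟨fun t => (z t).1 * X t, fun t => bΩ - (z t).2.1, fun t => bV - (z t).2.2,
    ⟨fun t ht => mul_mem_SE3 (hz t ht).1 (hX_mem t ht), fun t ht => ?_, fun t ht => ?_,
      fun t ht => ?_⟩, fun t ht => ?_⟩
  · have hXt := hX_mem t ht
    have hE := (HasDerivWithinAt.fst_fun (hz t ht).2).mul (hX_ode t ht)
    refine hE.congr_deriv ?_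
    rw [innovation_eq_twist, innovOmega_output k hyo hXt, innovV_output k hyo hXt, hcancel t ht,
      ← innovation_eq_twist, add_sub_assoc, twist_sub, sub_sub_cancel, sub_sub_cancel, mul_add,
      mul_assoc _ (X t) (twist _ _)]
    have := errVelocity_mul (yo := yo) (k := k) (mul_mem_SE3 (hz t ht).1 hXt) (z t)
    simp only [errField]
    rw [mul_assoc (errVelocity _ _ _ _), this]
    noncomm_ring
  · have hXt := hX_mem t ht
    refine ((HasDerivWithinAt.fst_fun (HasDerivWithinAt.snd_fun (hz t ht).2)).const_sub bΩ).congr_deriv ?_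
    rw [innovOmega_output k hyo hXt, innovV_output k hyo hXt, hcancel t ht]
    simp only [errField, biasField, neg_sub]
  · have hXt := hX_mem t ht
    refine ((HasDerivWithinAt.snd_fun (HasDerivWithinAt.snd_fun (hz t ht).2)).const_sub bV).congr_deriv ?_
    rw [innovV_output k hyo hXt, hcancel t ht]
    simp only [errField, biasField, neg_sub]
  · simp only [hcancel t ht, twist_sub, sub_sub_cancel]

variable (yo k kb) in
/-- The Lyapunov function: misalignment plus weighted bias error energy. -/
def lyapunov (z : ErrState) : ℝ :=
  misalignment yo k z.1 + (2 * kb)⁻¹ * ‖twist z.2.1 z.2.2‖ ^ 2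

/-- With `U = Ad(b̃) - Δ`, the misalignment contributes `-‖Δ‖²` plus terms linear in the bias error.
The bias energy produces the opposite linear terms, and the saturation terms are nonpositive. -/
theorem IsErrSolution.exists_hasDerivWithinAt_lyapunov (hyo : ∀ i, yo i ≠ 0) (hkb : 0 < kb)
    (hκΩ : 0 ≤ κΩ) (hκV : 0 ≤ κV) (hbΩ : eNorm bΩ ≤ δΩ) (hbV : eNorm bV ≤ δV)
    {z : ℝ → ErrState} (hz : IsErrSolution yo k kb κΩ κV δΩ δV bΩ bV X J z) :
    ∃ d : ℝ → ℝ, ∀ t ∈ J, HasDerivWithinAt (fun s => lyapunov yo k kb (z s)) (d t) J t ∧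
      d t ≤ -‖innovation yo k (z t).1 yo‖ ^ 2 := by
  have key : ∀ t ∈ J, ∃ d, HasDerivWithinAt (fun s => lyapunov yo k kb (z s)) d J t ∧
      d ≤ -‖innovation yo k (z t).1 yo‖ ^ 2 := by
    intro t ht
    obtain ⟨hmem, hder⟩ := hz t ht
    have h1 := hasDerivWithinAt_misalignment (yo := yo) k (HasDerivWithinAt.fst_fun hder)
      (fun i => mulVec_ne_zero_of_mem_SE3 hmem (hyo i))
    have hw := HasDerivWithinAt.fst_fun (HasDerivWithinAt.snd_fun hder)
    have hv := HasDerivWithinAt.snd_fun (HasDerivWithinAt.snd_fun hder)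
    have h2 := ((HasDerivWithinAt.dotProduct_fun hw hw).const_mul 2).add
      (HasDerivWithinAt.dotProduct_fun hv hv)
    have h3 := h1.add (h2.const_mul (2 * kb)⁻¹)
    simp only [lyapunov, norm_twist_sq]
    refine ⟨_, h3, ?_⟩
    rw [innovation_eq_twist, norm_twist_sq]
    have sΩ := dotProduct_sub_sat_nonpos hbΩ (bΩ - (z t).2.1)
    have sV := dotProduct_sub_sat_nonpos hbV (bV - (z t).2.2)
    rw [sub_sub_cancel] at sΩ sV
    simp only [errField, biasField]
    set R := rotPart ((z t).1 * X t)
    set p := posPart ((z t).1 * X t)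
    set w := (z t).2.1
    set v := (z t).2.2
    set ΩD := innovOmega yo k (z t).1 yo
    set VD := innovV yo k (z t).1 yo
    set sw := bΩ - w - sat δΩ (bΩ - w)
    set sv := bV - v - sat δV (bV - v)
    have htr : ∀ (u x : Vec3), u ⬝ᵥ (Rᵀ *ᵥ x) = (R *ᵥ u) ⬝ᵥ x := by
      intro u x
      rw [Matrix.dotProduct_mulVec, Matrix.vecMul_transpose]
    -- This identity makes the translation part of the adjoint cancel the term `(1 / 2) V_Δ × p̂` of
    -- the bias law.
    have htriple : crossProduct (R *ᵥ w) p ⬝ᵥ VD = -((R *ᵥ w) ⬝ᵥ crossProduct VD p) := by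
      simp [cross_apply, dotProduct, Fin.sum_univ_three]
      ring
    rw [dotProduct_comm _ w, dotProduct_comm _ v]
    simp only [sub_dotProduct, dotProduct_sub, dotProduct_smul, dotProduct_add, htr, smul_eq_mul,
      htriple]
    have e1 : (2 * kb)⁻¹ * (κΩ * (w ⬝ᵥ sw)) ≤ 0 := by
      apply mul_nonpos_of_nonneg_of_nonpos (by positivity)
      exact mul_nonpos_of_nonneg_of_nonpos hκΩ sΩ
    have e2 : (2 * kb)⁻¹ * (κV * (v ⬝ᵥ sv)) ≤ 0 := by
      apply mul_nonpos_of_nonneg_of_nonpos (by positivity)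
      exact mul_nonpos_of_nonneg_of_nonpos hκV sV
    have e3 : (2 * kb)⁻¹ * kb = 1 / 2 := by field_simp
    set q := (2 * kb)⁻¹
    have hq : ∀ x : ℝ, q * (kb * x) = 1 / 2 * x := fun x => by rw [← mul_assoc, e3]
    simp only [mul_add, mul_sub, hq, mul_left_comm q 2]
    linarith
  choose! d hd using key
  exact ⟨d, hd⟩


/-! ### Continuous differentiability of the error field without saturation. -/

section Smoothness

variable {V : Type*} [NormedAddCommGroup V] [NormedSpace ℝ V] {x₀ : V} {m n : Type*} [Fintype m]
  [Fintype n]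

theorem contDiffAt_linearMap_comp {W₁ W₂ : Type*} [NormedAddCommGroup W₁] [NormedSpace ℝ W₁]
    [FiniteDimensional ℝ W₁] [NormedAddCommGroup W₂] [NormedSpace ℝ W₂] (L : W₁ →ₗ[ℝ] W₂)
    {f : V → W₁} (hf : ContDiffAt ℝ 1 f x₀) : ContDiffAt ℝ 1 (fun x => L (f x)) x₀ :=
  (LinearMap.toContinuousLinearMap L).contDiff.contDiffAt.comp x₀ hf

theorem contDiffAt_dotProduct {u v : V → n → ℝ} (hu : ContDiffAt ℝ 1 u x₀)
    (hv : ContDiffAt ℝ 1 v x₀) : ContDiffAt ℝ 1 (fun x => u x ⬝ᵥ v x) x₀ :=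
  ContDiffAt.sum fun j _ => (contDiffAt_pi.1 hu j).mul (contDiffAt_pi.1 hv j)

theorem contDiffAt_mulVec {M : V → Matrix m n ℝ} {u : V → n → ℝ} (hM : ContDiffAt ℝ 1 M x₀)
    (hu : ContDiffAt ℝ 1 u x₀) : ContDiffAt ℝ 1 (fun x => M x *ᵥ u x) x₀ :=
  contDiffAt_pi.2 fun i => ContDiffAt.sum fun j _ =>
    (contDiffAt_linearMap_comp (Matrix.entryLinearMap ℝ ℝ i j) hM).mul (contDiffAt_pi.1 hu j)

theorem contDiffAt_crossProduct {u v : V → Vec3} (hu : ContDiffAt ℝ 1 u x₀)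
    (hv : ContDiffAt ℝ 1 v x₀) : ContDiffAt ℝ 1 (fun x => crossProduct (u x) (v x)) x₀ := by
  have hu' := contDiffAt_pi.1 hu
  have hv' := contDiffAt_pi.1 hv
  refine contDiffAt_pi.2 fun i => ?_
  fin_cases i <;> simp only [cross_apply] <;>
    exact ((hu' _).mul (hv' _)).sub ((hu' _).mul (hv' _))

/-- `twist` as a linear map. -/
def twistLin : Vec3 × Vec3 →ₗ[ℝ] Mat4 where
  toFun p := twist p.1 p.2
  map_add' p q := by
    ext (i | i) (j | j)
    · fin_cases i <;> fin_cases j <;> simp [twist, skew] <;> ring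
    all_goals simp [twist]
  map_smul' c p := by
    ext (i | i) (j | j)
    · fin_cases i <;> fin_cases j <;> simp [twist, skew]
    all_goals simp [twist]

theorem twistLin_apply (a c : Vec3) : twistLin (a, c) = twist a c := rfl

/-- `rotPart` as a linear map. -/
def rotPartLin : Mat4 →ₗ[ℝ] Mat3 where
  toFun := rotPart
  map_add' _ _ := rfl
  map_smul' _ _ := rfl

/-- The transpose of `rotPart` as a linear map. -/
def rotPartTransposeLin : Mat4 →ₗ[ℝ] Mat3 where
  toFun X := (rotPart X)ᵀ
  map_add' _ _ := rfl
  map_smul' _ _ := rfl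

/-- `posPart` as a linear map. -/
def posPartLin : Mat4 →ₗ[ℝ] Vec3 where
  toFun := posPart
  map_add' _ _ := rfl
  map_smul' _ _ := rfl

/-- `projSe3` as a linear map. -/
def projSe3Lin : Mat4 →ₗ[ℝ] Mat4 where
  toFun := projSe3
  map_add' M M' := by
    ext (i | i) (j | j) <;> simp [projSe3, Matrix.toBlocks₁₁, Matrix.toBlocks₁₂]
    ring
  map_smul' c M := by
    ext (i | i) (j | j) <;> simp [projSe3, Matrix.toBlocks₁₁, Matrix.toBlocks₁₂]
    ring

theorem contDiffAt_outErr {E : V → Mat4} (hE : ContDiffAt ℝ 1 E x₀) {y : Vec4}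
    (hy : E x₀ *ᵥ y ≠ 0) : ContDiffAt ℝ 1 (fun x => outErr (E x) y) x₀ := by
  have hw : ContDiffAt ℝ 1 (fun x => E x *ᵥ y) x₀ := contDiffAt_mulVec hE contDiffAt_const
  have hpos : 0 < (E x₀ *ᵥ y) ⬝ᵥ (E x₀ *ᵥ y) :=
    (dotProduct_self_nonneg' _).lt_of_ne' fun h => hy (dotProduct_self_eq_zero.1 h)
  exact (((contDiffAt_dotProduct hw hw).sqrt hpos.ne').inv (Real.sqrt_pos.2 hpos).ne').smul hw

theorem contDiffAt_vecPart {e : V → Vec4} (he : ContDiffAt ℝ 1 e x₀) :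
    ContDiffAt ℝ 1 (fun x => vecPart (e x)) x₀ :=
  contDiffAt_pi.2 fun i => contDiffAt_pi.1 he (Sum.inl i)

variable {N : ℕ} {yo : Fin N → Vec4} {k : Fin N → ℝ}

theorem contDiffAt_innovOmega {E : V → Mat4} (hE : ContDiffAt ℝ 1 E x₀)
    (hy : ∀ i, E x₀ *ᵥ yo i ≠ 0) : ContDiffAt ℝ 1 (fun x => innovOmega yo k (E x) yo) x₀ := by
  refine ContDiffAt.neg (ContDiffAt.const_smul _ (ContDiffAt.sum fun i _ =>
    ContDiffAt.const_smul _ (contDiffAt_crossProduct ?_ contDiffAt_const)))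
  exact contDiffAt_vecPart (contDiffAt_outErr hE (hy i))

theorem contDiffAt_innovV {E : V → Mat4} (hE : ContDiffAt ℝ 1 E x₀)
    (hy : ∀ i, E x₀ *ᵥ yo i ≠ 0) : ContDiffAt ℝ 1 (fun x => innovV yo k (E x) yo) x₀ := by
  refine ContDiffAt.sum fun i _ => ?_
  have he := contDiffAt_outErr hE (hy i)
  exact (contDiffAt_const.mul (contDiffAt_pi.1 he _)).smul
    (((contDiffAt_dotProduct he contDiffAt_const).smul (contDiffAt_vecPart he)).sub
      contDiffAt_const)

theorem contDiffAt_errVelocity {Xh : V → Mat4} {z : V → ErrState} (hXh : ContDiffAt ℝ 1 Xh x₀)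
    (hz : ContDiffAt ℝ 1 z x₀) (hy : ∀ i, (z x₀).1 *ᵥ yo i ≠ 0) :
    ContDiffAt ℝ 1 (fun x => errVelocity yo k (Xh x) (z x)) x₀ := by
  have hR : ContDiffAt ℝ 1 (fun x => rotPart (Xh x)) x₀ :=
    contDiffAt_linearMap_comp rotPartLin hXh
  have hp : ContDiffAt ℝ 1 (fun x => posPart (Xh x)) x₀ :=
    contDiffAt_linearMap_comp posPartLin hXh
  have hRw := contDiffAt_mulVec hR hz.snd.fst
  have hRv := contDiffAt_mulVec hR hz.snd.snd
  have hΩ := contDiffAt_innovOmega (k := k) hz.fst hy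
  have hV := contDiffAt_innovV (k := k) hz.fst hy
  have h1 := hRw.sub hΩ
  have h2 := (hRv.sub (contDiffAt_crossProduct hRw hp)).sub hV
  simp only [errVelocity, ← twistLin_apply]
  exact contDiffAt_linearMap_comp twistLin (h1.prodMk h2)

theorem contDiffAt_biasField {kb : ℝ} {Xh E : V → Mat4} (hXh : ContDiffAt ℝ 1 Xh x₀)
    (hE : ContDiffAt ℝ 1 E x₀) (hy : ∀ i, E x₀ *ᵥ yo i ≠ 0) :
    ContDiffAt ℝ 1 (fun x => biasField yo k kb (Xh x) (E x)) x₀ := by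
  have hRt := contDiffAt_linearMap_comp rotPartTransposeLin hXh
  have hp := contDiffAt_linearMap_comp posPartLin hXh
  have hΩ := contDiffAt_innovOmega (k := k) hE hy
  have hV := contDiffAt_innovV (k := k) hE hy
  exact ((contDiffAt_mulVec hRt
    (hΩ.add ((contDiffAt_crossProduct hV hp).const_smul (1 / 2 : ℝ)))).const_smul kb).prodMk
      ((contDiffAt_mulVec hRt hV).const_smul kb)

/-- The part of the error field that is continuously differentiable. -/
def smoothField (yo : Fin N → Vec4) (k : Fin N → ℝ) (kb κΩ κV : ℝ) (bΩ bV : Vec3)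
    (q : Mat4 × ErrState) : ErrState :=
  (errVelocity yo k (q.2.1 * q.1) q.2 * q.2.1,
    κΩ • (bΩ - q.2.2.1) - (biasField yo k kb (q.2.1 * q.1) q.2.1).1,
    κV • (bV - q.2.2.2) - (biasField yo k kb (q.2.1 * q.1) q.2.1).2)

theorem contDiffAt_smoothField {kb κΩ κV : ℝ} {bΩ bV : Vec3} {q : Mat4 × ErrState}
    (hq : ∀ i, q.2.1 *ᵥ yo i ≠ 0) :
    ContDiffAt ℝ 1 (smoothField yo k kb κΩ κV bΩ bV) q := by
  have hX : ContDiffAt ℝ 1 (fun q : Mat4 × ErrState => q.1) q := contDiffAt_fst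
  have hz : ContDiffAt ℝ 1 (fun q : Mat4 × ErrState => q.2) q := contDiffAt_snd
  have hXh := hz.fst.mul hX
  have hU := contDiffAt_errVelocity (k := k) hXh hz hq
  have hB := contDiffAt_biasField (k := k) (kb := kb) hXh hz.fst hq
  exact (hU.mul hz.fst).prodMk
    ((((contDiffAt_const (c := bΩ)).sub hz.snd.fst).const_smul κΩ |>.sub hB.fst).prodMk
      (((contDiffAt_const (c := bV)).sub hz.snd.snd).const_smul κV |>.sub hB.snd))

end Smoothness

/-! ### Lipschitz continuity of the error field near the equilibrium. -/

section Regularity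

variable {N : ℕ} {yo : Fin N → Vec4} {k : Fin N → ℝ} {kb κΩ κV δΩ δV : ℝ} {bΩ bV : Vec3}

/-- Near the identity, the outputs of the error do not degenerate. -/
theorem exists_ball_mulVec_ne_zero (hyo : ∀ i, yo i ≠ 0) :
    ∃ r > 0, ∀ E : Mat4, dist E 1 ≤ r → ∀ i, E *ᵥ yo i ≠ 0 := by
  have h : ∀ᶠ E : Mat4 in 𝓝 1, ∀ i, E *ᵥ yo i ≠ 0 := by
    rw [eventually_all]
    intro i
    have hc : ContinuousAt (fun E : Mat4 => E *ᵥ yo i) 1 :=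
      (contDiffAt_mulVec contDiffAt_id contDiffAt_const).continuousAt
    refine hc.eventually_ne ?_
    rw [Matrix.one_mulVec]
    exact hyo i
  obtain ⟨r, hr, h⟩ := Metric.nhds_basis_closedBall.eventually_iff.1 h
  exact ⟨r, hr, fun E hE => h hE⟩

/-- The saturations are Lipschitz but need not be differentiable, so they are split off; the rest is
`C¹` on a compact convex set. Letting the true pose range over a ball makes the constant uniform in
time. -/
theorem exists_lipschitzOnWith_errField (hδΩ : 0 ≤ δΩ) (hδV : 0 ≤ δV) {r : ℝ}
    (hr : ∀ E : Mat4, dist E 1 ≤ r → ∀ i, E *ᵥ yo i ≠ 0) (C : ℝ) :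
    ∃ K, LipschitzOnWith K
      (fun q : Mat4 × ErrState => errField yo k kb κΩ κV δΩ δV bΩ bV q.1 q.2)
      (Metric.closedBall 0 C ×ˢ Metric.closedBall (1, 0, 0) r) := by
  have hsm : ContDiffOn ℝ 1 (smoothField yo k kb κΩ κV bΩ bV)
      (Metric.closedBall 0 C ×ˢ Metric.closedBall (1, 0, 0) r) := by
    rintro ⟨X, z⟩ ⟨-, hz⟩
    refine (contDiffAt_smoothField fun i => ?_).contDiffWithinAt
    exact hr _ ((le_max_left _ _).trans hz) i
  obtain ⟨K, hK⟩ := hsm.exists_lipschitzOnWith one_ne_zero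
    ((convex_closedBall _ _).prod (convex_closedBall _ _))
    ((isCompact_closedBall _ _).prod (isCompact_closedBall _ _))
  obtain ⟨KΩ, hKΩ⟩ := exists_lipschitzWith_sat hδΩ
  obtain ⟨KV, hKV⟩ := exists_lipschitzWith_sat hδV
  have hw : LipschitzWith (1 * 1 * 1) (fun q : Mat4 × ErrState => q.2.2.1) :=
    (LipschitzWith.prod_fst.comp LipschitzWith.prod_snd).comp LipschitzWith.prod_snd
  have hv : LipschitzWith (1 * 1 * 1) (fun q : Mat4 × ErrState => q.2.2.2) :=
    (LipschitzWith.prod_snd.comp LipschitzWith.prod_snd).comp LipschitzWith.prod_snd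
  have hsΩ := (lipschitzWith_smul κΩ).comp
    (hKΩ.comp ((LipschitzWith.const (α := Mat4 × ErrState) bΩ).sub hw))
  have hsV := (lipschitzWith_smul κV).comp
    (hKV.comp ((LipschitzWith.const (α := Mat4 × ErrState) bV).sub hv))
  have hs := (LipschitzWith.const (α := Mat4 × ErrState) (0 : Mat4)).prodMk (hsΩ.prodMk hsV)
  have e : (fun q : Mat4 × ErrState => errField yo k kb κΩ κV δΩ δV bΩ bV q.1 q.2) =
      fun q => smoothField yo k kb κΩ κV bΩ bV q -
        (0, κΩ • sat δΩ (bΩ - q.2.2.1), κV • sat δV (bV - q.2.2.2)) := by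
    funext q
    simp only [smoothField, errField, Prod.mk_sub_mk, sub_zero, smul_sub]
    congr 2 <;> abel
  rw [e]
  exact ⟨_, hK.sub hs.lipschitzOnWith⟩

end Regularity


/-! ### Infinitesimal consequences of observability. -/

section Observability

theorem eq_smul_of_cross_eq_zero {a w : Vec3} (ha : a ≠ 0) (h : crossProduct a w = 0) :
    w = ((a ⬝ᵥ a)⁻¹ * (a ⬝ᵥ w)) • a := by
  have h1 := cross_cross_eq_smul_sub_smul' a a w
  rw [h, map_zero] at h1
  have h2 : a ⬝ᵥ a ≠ 0 := fun h0 => ha (dotProduct_self_eq_zero.1 h0)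
  rw [mul_smul, eq_inv_smul_iff₀ h2]
  exact (sub_eq_zero.1 h1.symm).symm

theorem collinear_of_cross_eq_zero {a : Vec3} (ha : a ≠ 0) {s : Set Vec3}
    (h : ∀ w ∈ s, crossProduct a w = 0) (h0 : (0 : Vec3) ∈ s) : Collinear ℝ s := by
  rw [collinear_iff_of_mem h0]
  refine ⟨a, fun w hw => ⟨(a ⬝ᵥ a)⁻¹ * (a ⬝ᵥ w), ?_⟩⟩
  rw [vadd_eq_add, add_zero]
  exact eq_smul_of_cross_eq_zero ha (h w hw)

theorem eq_or_eq_neg_of_cross_eq_zero {a w₁ w₂ : Vec3} (ha : a ≠ 0) (h₁ : crossProduct a w₁ = 0)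
    (h₂ : crossProduct a w₂ = 0) (h : w₁ ⬝ᵥ w₁ = w₂ ⬝ᵥ w₂) : w₁ = w₂ ∨ w₁ = -w₂ := by
  have e₁ := eq_smul_of_cross_eq_zero ha h₁
  have e₂ := eq_smul_of_cross_eq_zero ha h₂
  set c₁ := (a ⬝ᵥ a)⁻¹ * (a ⬝ᵥ w₁)
  set c₂ := (a ⬝ᵥ a)⁻¹ * (a ⬝ᵥ w₂)
  have h3 : a ⬝ᵥ a ≠ 0 := fun h0 => ha (dotProduct_self_eq_zero.1 h0)
  rw [e₁, e₂] at h
  simp only [dotProduct_smul, smul_dotProduct, smul_eq_mul, ← mul_assoc] at h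
  rcases mul_self_eq_mul_self_iff.1 (mul_right_cancel₀ h3 h) with h4 | h4
  · left; rw [e₁, e₂, h4]
  · right; rw [e₁, e₂, h4, neg_smul]

theorem dotProduct_self_eq_vecPart (y : Vec4) :
    y ⬝ᵥ y = vecPart y ⬝ᵥ vecPart y + fourth y ^ 2 := by
  simp [dotProduct, vecPart, fourth, sq]

theorem vec4_ext {y z : Vec4} (h : vecPart y = vecPart z) (h4 : fourth y = fourth z) : y = z := by
  ext (i | i)
  · exact congrFun h i
  · exact h4

variable {N : ℕ} {yo : Fin N → Vec4}

/-- An infinitesimal rigid motion that fixes an observable family of directions is trivial. -/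
theorem Observable.eq_zero (hobs : Observable yo) (hyo : ∀ i, eNorm (yo i) = 1) {a c : Vec3}
    (h : ∀ i, crossProduct a (vecPart (yo i)) + fourth (yo i) • c = 0) : a = 0 ∧ c = 0 := by
  have hc : ∀ j, fourth (yo j) ≠ 0 → a = 0 → a = 0 ∧ c = 0 := by
    intro j hj ha
    have := h j
    rw [ha, map_zero, LinearMap.zero_apply, zero_add] at this
    exact ⟨ha, (smul_eq_zero.1 this).resolve_left hj⟩
  have h0 : ∀ i, fourth (yo i) = 0 → crossProduct a (vecPart (yo i)) = 0 := by
    intro i hi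
    simpa [hi] using h i
  -- The combination defining `resultant` is the one that eliminates `c`.
  have hres : ∀ i j, crossProduct a (resultant (yo i) (yo j)) = 0 := by
    intro i j
    rw [resultant, map_sub, map_smul, map_smul, eq_neg_of_add_eq_zero_left (h i),
      eq_neg_of_add_eq_zero_left (h j)]
    module
  -- If `a ≠ 0`, everything annihilated by `a ×` lies on the line of `a`, which each of the three
  -- cases excludes. Once `a = 0`, a point with nonzero fourth component gives `c = 0`.
  rcases hobs with ⟨i₁, i₂, j, hd, h1, h2, hj⟩ | ⟨i, j₁, j₂, hi, -, hj, -, hcol⟩ |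
    ⟨j₁, j₂, j₃, -, -, -, hj, -, -, hcol⟩
  · refine hc j hj (by_contra fun ha => ?_)
    have hn : ∀ i, fourth (yo i) = 0 → vecPart (yo i) ⬝ᵥ vecPart (yo i) = 1 := by
      intro i hi
      have := dotProduct_self_eq_vecPart (yo i)
      rw [← eNorm_sq, hyo, hi] at this
      linarith
    rcases eq_or_eq_neg_of_cross_eq_zero ha (h0 i₁ h1) (h0 i₂ h2)
      ((hn i₁ h1).trans (hn i₂ h2).symm) with h3 | h3
    · exact hd.1 (vec4_ext h3 (h1.trans h2.symm))
    · refine hd.2 (vec4_ext h3 ?_)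
      change fourth (yo i₁) = -fourth (yo i₂)
      rw [h1, h2, neg_zero]
  · refine hc j₁ hj (by_contra fun ha => hcol (collinear_of_cross_eq_zero ha ?_ (by simp)))
    rintro w (rfl | rfl | rfl)
    · exact map_zero _
    · exact h0 i hi
    · exact hres _ _
  · refine hc j₁ hj (by_contra fun ha => hcol (collinear_of_cross_eq_zero ha ?_ (by simp)))
    rintro w (rfl | rfl | rfl | rfl)
    · exact map_zero _
    all_goals exact hres _ _

end Observability

/-! ### Linearization of the innovation and its coercivity. -/

section Coercivity

variable {N : ℕ} (yo : Fin N → Vec4) (k : Fin N → ℝ)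

theorem vecMulVec_conj (u y : Vec4) (Z : Mat4) :
    (1 - Matrix.vecMulVec u u) * Z * Matrix.vecMulVec y u =
      Matrix.vecMulVec (Z *ᵥ y - (u ⬝ᵥ (Z *ᵥ y)) • u) u := by
  rw [mul_assoc, Matrix.mul_vecMulVec, sub_mul, one_mul, Matrix.vecMulVec_mul_vecMulVec,
    Matrix.sub_vecMulVec]
  simp

/-- What `projSe3` annihilates is orthogonal to `𝔰𝔢(3)`. -/
theorem trace_transpose_twist_mul {M : Mat4} (hM : projSe3 M = 0) (a c : Vec3) :
    ((twist a c)ᵀ * M).trace = 0 := by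
  have h1 : ∀ i j : Fin 3, M (Sum.inl i) (Sum.inl j) = M (Sum.inl j) (Sum.inl i) := by
    intro i j
    have := congrFun (congrFun hM (Sum.inl i)) (Sum.inl j)
    simp [projSe3, Matrix.toBlocks₁₁] at this
    linarith
  have h2 : ∀ (i : Fin 3) (j : Unit), M (Sum.inl i) (Sum.inr j) = 0 := by
    intro i j
    have := congrFun (congrFun hM (Sum.inl i)) (Sum.inr j)
    simpa [projSe3, Matrix.toBlocks₁₂] using this
  simp [Matrix.trace, Matrix.mul_apply, twist, skew, Fin.sum_univ_three, h2, h1 1 0, h1 2 0,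
    h1 2 1]
  ring

/-- The linearization of the innovation at the identity. -/
def innovationLin : Mat4 →ₗ[ℝ] Mat4 :=
  projSe3Lin ∘ₗ ∑ i, k i • (LinearMap.mulLeft ℝ (1 - Matrix.vecMulVec (yo i) (yo i)) ∘ₗ
    LinearMap.mulRight ℝ (Matrix.vecMulVec (yo i) (yo i)))

theorem innovationLin_apply (Z : Mat4) : innovationLin yo k Z = projSe3Lin (∑ i, k i •
    ((1 - Matrix.vecMulVec (yo i) (yo i)) * Z * Matrix.vecMulVec (yo i) (yo i))) := by
  simp [innovationLin, mul_assoc]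

variable {yo} {k}

/-- Pairing with the twist itself gives `∑ kᵢ |(1 - ẙᵢẙᵢᵀ) Z ẙᵢ|² = 0`, so each `ẙᵢ` is an
eigenvector of `Z`. The zero last row forces the eigenvalue times `ẙᵢ₄` to vanish; the eigenvalue
itself has the factor `ẙᵢ₄`, so it is zero and observability applies. -/
theorem eq_zero_of_innovationLin_twist_eq_zero (hobs : Observable yo)
    (hyo : ∀ i, eNorm (yo i) = 1) (hk : ∀ i, 0 < k i) {a c : Vec3}
    (h : innovationLin yo k (twist a c) = 0) : a = 0 ∧ c = 0 := by
  rw [innovationLin_apply] at h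
  have htr := trace_transpose_twist_mul h a c
  have hterm : ∀ i, ((twist a c)ᵀ * ((1 - Matrix.vecMulVec (yo i) (yo i)) * twist a c *
      Matrix.vecMulVec (yo i) (yo i))).trace =
      eNorm (twist a c *ᵥ yo i - (yo i ⬝ᵥ (twist a c *ᵥ yo i)) • yo i) ^ 2 := by
    intro i
    have h1 : yo i ⬝ᵥ yo i = 1 := by rw [← eNorm_sq, hyo, one_pow]
    rw [vecMulVec_conj, Matrix.mul_vecMulVec, Matrix.trace_vecMulVec, Matrix.mulVec_transpose,
      ← Matrix.dotProduct_mulVec, eNorm_sq]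
    simp only [sub_dotProduct, dotProduct_sub, smul_dotProduct, dotProduct_smul, smul_eq_mul, h1]
    rw [dotProduct_comm _ (yo i)]
    ring
  simp only [Finset.mul_sum, Matrix.mul_smul, Matrix.trace_sum, Matrix.trace_smul, hterm,
    smul_eq_mul] at htr
  rw [Finset.sum_eq_zero_iff_of_nonneg
    (fun i _ => mul_nonneg (hk i).le (sq_nonneg _))] at htr
  refine hobs.eq_zero hyo fun i => ?_
  have h2 : twist a c *ᵥ yo i = (yo i ⬝ᵥ (twist a c *ᵥ yo i)) • yo i := by
    have h3 := (mul_eq_zero.1 (htr i (Finset.mem_univ i))).resolve_left (hk i).ne'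
    rw [eNorm_sq] at h3
    exact sub_eq_zero.1 (dotProduct_self_eq_zero.1 h3)
  rw [dotProduct_twist_mulVec_self] at h2
  set l := fourth (yo i) * c ⬝ᵥ vecPart (yo i) with hl
  have h4 : crossProduct a (vecPart (yo i)) + fourth (yo i) • c = l • vecPart (yo i) := by
    ext j
    have := congrFun h2 (Sum.inl j)
    rw [twist_mulVec] at this
    exact this
  have h5 : 0 = l * fourth (yo i) := by
    have := congrFun h2 (Sum.inr ())
    rw [twist_mulVec] at this
    exact this
  have h6 : l = 0 := by
    rcases mul_eq_zero.1 h5.symm with h7 | h7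
    · exact h7
    · rw [hl, h7, zero_mul]
  rw [h4, h6, zero_smul]

/-- The last row of a matrix. -/
def lastRowLin : Mat4 →ₗ[ℝ] Vec4 where
  toFun Z := Z (Sum.inr ())
  map_add' _ _ := rfl
  map_smul' _ _ := rfl

variable (yo k) in
/-- The linearization of the innovation together with the linearized constraints of `SE(3)`. -/
def constraintLin : Mat4 →ₗ[ℝ] Mat4 × Mat3 × Vec4 :=
  (innovationLin yo k).prod ((rotPartLin + rotPartTransposeLin).prod lastRowLin)

/-- The two constraint components vanish exactly on `𝔰𝔢(3)`. Adding them to the innovation turns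
injectivity on the tangent space into injectivity on all matrices, so no chart of `SE(3)` is needed.
-/
theorem injective_constraintLin (hobs : Observable yo)
    (hyo : ∀ i, eNorm (yo i) = 1) (hk : ∀ i, 0 < k i) :
    Function.Injective (constraintLin yo k) := by
  rw [injective_iff_map_eq_zero]
  intro Z hZ
  have h1 : innovationLin yo k Z = 0 := congrArg Prod.fst hZ
  have h2 : rotPart Z + (rotPart Z)ᵀ = 0 := congrArg (fun p => p.2.1) hZ
  have h3 : Z (Sum.inr ()) = 0 := congrArg (fun p => p.2.2) hZ
  have hZ' : Z = twist ![Z (Sum.inl 2) (Sum.inl 1), Z (Sum.inl 0) (Sum.inl 2),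
      Z (Sum.inl 1) (Sum.inl 0)] (posPart Z) := by
    have hs : ∀ i j : Fin 3, Z (Sum.inl i) (Sum.inl j) = -Z (Sum.inl j) (Sum.inl i) := fun i j =>
      eq_neg_of_add_eq_zero_left (congrFun (congrFun h2 i) j)
    have hd : ∀ i : Fin 3, Z (Sum.inl i) (Sum.inl i) = 0 := fun i => by linarith [hs i i]
    ext (i | i) (j | j)
    · fin_cases i <;> fin_cases j <;> simp [twist, skew, hd] <;> exact hs _ _
    · rfl
    · exact congrFun h3 _
    · exact congrFun h3 _
  rw [hZ'] at h1
  obtain ⟨ha, hc⟩ := eq_zero_of_innovationLin_twist_eq_zero hobs hyo hk h1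
  rw [hZ', ha, hc, twist_zero]

/-- The innovation, factored through the pose error `E - 1`. -/
theorem innovation_eq_projSe3Lin {E : Mat4} (hE : ∀ i, E *ᵥ yo i ≠ 0) :
    innovation yo k E yo = projSe3Lin (∑ i, k i •
      ((1 - Matrix.vecMulVec (outErr E (yo i)) (outErr E (yo i))) * (E - 1) *
        Matrix.vecMulVec (yo i) (outErr E (yo i)))) := by
  -- The projection `1 - e eᵀ` kills `E y`, which is parallel to `e`.
  have h : ∀ i, (1 - Matrix.vecMulVec (outErr E (yo i)) (outErr E (yo i))) * (E - 1) *
      Matrix.vecMulVec (yo i) (outErr E (yo i)) =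
      -((1 - Matrix.vecMulVec (outErr E (yo i)) (outErr E (yo i))) *
        Matrix.vecMulVec (yo i) (outErr E (yo i))) := by
    intro i
    have h0 := eNorm_pos (hE i)
    have he : E *ᵥ yo i = eNorm (E *ᵥ yo i) • outErr E (yo i) := by
      rw [outErr, normalize, smul_smul, mul_inv_cancel₀ h0.ne', one_smul]
    have hee : outErr E (yo i) ⬝ᵥ outErr E (yo i) = 1 := normalize_dotProduct_self (hE i)
    rw [mul_sub, sub_mul, mul_one, vecMulVec_conj, he, dotProduct_smul, hee, smul_eq_mul, mul_one,
      sub_self, Matrix.zero_vecMulVec, zero_sub]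
  simp only [h, smul_neg, Finset.sum_neg_distrib, map_neg]
  rfl

theorem norm_sub_mul_mul_le (A A₀ B B₀ Z : Mat4) :
    ‖A * Z * B - A₀ * Z * B₀‖ ≤ (‖A - A₀‖ * ‖B‖ + ‖A₀‖ * ‖B - B₀‖) * ‖Z‖ := by
  have e : A * Z * B - A₀ * Z * B₀ = (A - A₀) * Z * B + A₀ * Z * (B - B₀) := by noncomm_ring
  rw [e]
  calc _ ≤ ‖(A - A₀) * Z * B‖ + ‖A₀ * Z * (B - B₀)‖ := norm_add_le _ _
    _ ≤ ‖A - A₀‖ * ‖Z‖ * ‖B‖ + ‖A₀‖ * ‖Z‖ * ‖B - B₀‖ := by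
      gcongr <;> exact (norm_mul_le _ _).trans (by gcongr; exact norm_mul_le _ _)
    _ = _ := by ring

theorem exists_bound_linearMap {V W : Type*} [NormedAddCommGroup V] [NormedSpace ℝ V]
    [FiniteDimensional ℝ V] [NormedAddCommGroup W] [NormedSpace ℝ W] (L : V →ₗ[ℝ] W) :
    ∃ C > 0, ∀ x, ‖L x‖ ≤ C * ‖x‖ := by
  refine ⟨‖LinearMap.toContinuousLinearMap L‖ + 1, by positivity, fun x => ?_⟩
  refine ((LinearMap.toContinuousLinearMap L).le_opNorm x).trans ?_
  gcongr
  linarith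

/-- The innovation differs from its linearization by a small multiple of the pose error. -/
theorem eventually_norm_innovation_sub_le (hyo : ∀ i, eNorm (yo i) = 1) (hk : ∀ i, 0 ≤ k i)
    {η : ℝ} (hη : 0 < η) : ∀ᶠ E : Mat4 in 𝓝 1,
      ‖innovation yo k E yo - innovationLin yo k (E - 1)‖ ≤ η * ‖E - 1‖ := by
  obtain ⟨C, hC, hP⟩ := exists_bound_linearMap projSe3Lin
  -- Both sides are linear in the explicit factor `E - 1`, so it suffices that the other factors
  -- vary continuously. `β` measures their variation and vanishes at the identity.
  let β : Mat4 → ℝ := fun E => ∑ i, k i *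
    (‖(1 - Matrix.vecMulVec (outErr E (yo i)) (outErr E (yo i))) -
        (1 - Matrix.vecMulVec (yo i) (yo i))‖ * ‖Matrix.vecMulVec (yo i) (outErr E (yo i))‖ +
      ‖1 - Matrix.vecMulVec (yo i) (yo i)‖ *
        ‖Matrix.vecMulVec (yo i) (outErr E (yo i)) - Matrix.vecMulVec (yo i) (yo i)‖)
  have hne : ∀ i, (1 : Mat4) *ᵥ yo i ≠ 0 := fun i => by
    rw [Matrix.one_mulVec]; exact ne_zero_of_eNorm_eq_one (hyo i)
  have hβc : ContinuousAt β 1 := by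
    have hvm : ∀ u v : Mat4 → Vec4, ContinuousAt u 1 → ContinuousAt v 1 →
        ContinuousAt (fun E => Matrix.vecMulVec (u E) (v E)) 1 := by
      intro u v hu hv
      exact (Continuous.matrix_vecMulVec (A := fun p : Vec4 × Vec4 => p.1)
        continuous_fst continuous_snd).continuousAt.comp (hu.prodMk hv)
    refine tendsto_finsetSum _ fun i _ => ?_
    have he : ContinuousAt (fun E => outErr E (yo i)) 1 :=
      (contDiffAt_outErr contDiffAt_id (hne i)).continuousAt
    have h1 := hvm _ _ he he
    have h2 := hvm _ _ (continuousAt_const (y := yo i)) he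
    exact continuousAt_const.mul ((((continuousAt_const.sub h1).sub continuousAt_const).norm.mul
      h2.norm).add (continuousAt_const.mul (h2.sub continuousAt_const).norm))
  have hβ1 : β 1 = 0 := by simp [β, outErr_one (hyo _)]
  have hsmall : ∀ᶠ E in 𝓝 (1 : Mat4), β E < η / C := by
    refine hβc.eventually (gt_mem_nhds ?_)
    rw [hβ1]
    positivity
  obtain ⟨r, hr, hball⟩ := exists_ball_mulVec_ne_zero fun i => ne_zero_of_eNorm_eq_one (hyo i)
  filter_upwards [hsmall, Metric.closedBall_mem_nhds _ hr] with E hE hEr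
  rw [innovation_eq_projSe3Lin (hball E hEr), innovationLin_apply, ← map_sub,
    ← Finset.sum_sub_distrib]
  refine (hP _).trans ?_
  have h1 : ‖∑ i, (k i • ((1 - Matrix.vecMulVec (outErr E (yo i)) (outErr E (yo i))) * (E - 1) *
        Matrix.vecMulVec (yo i) (outErr E (yo i))) -
      k i • ((1 - Matrix.vecMulVec (yo i) (yo i)) * (E - 1) *
        Matrix.vecMulVec (yo i) (yo i)))‖ ≤ β E * ‖E - 1‖ := by
    refine (norm_sum_le _ _).trans ?_
    rw [Finset.sum_mul]
    refine Finset.sum_le_sum fun i _ => ?_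
    rw [← smul_sub, norm_smul, Real.norm_of_nonneg (hk i), mul_assoc (k i)]
    exact mul_le_mul_of_nonneg_left (norm_sub_mul_mul_le _ _ _ _ _) (hk i)
  calc _ ≤ C * (β E * ‖E - 1‖) := by gcongr
    _ ≤ C * (η / C * ‖E - 1‖) := by gcongr
    _ = η * ‖E - 1‖ := by field_simp

/-- For `Z = R - 1`, orthogonality reads `Z + Zᵀ = -Zᵀ Z`: on `SE(3)` the linearized constraints
fail only to second order. -/
theorem constraintLin_sub_one {E : Mat4} (hE : E ∈ SE3) :
    constraintLin yo k (E - 1) =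
      (innovationLin yo k (E - 1), -((rotPart (E - 1))ᵀ * rotPart (E - 1)), 0) := by
  obtain ⟨R, hR, p, rfl⟩ := hE
  have hsub : rotPart (pose R p - 1) = R - 1 := by
    change rotPart (pose R p) - rotPart 1 = _
    rw [rotPart_pose, ← pose_one_zero, rotPart_pose]
  have h1 := (mem_SO_iff.1 hR).1
  refine Prod.ext rfl (Prod.ext ?_ ?_)
  · change rotPart (pose R p - 1) + (rotPart (pose R p - 1))ᵀ = _
    rw [hsub, Matrix.transpose_sub, Matrix.transpose_one, sub_mul, mul_sub, mul_sub, h1]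
    noncomm_ring
  · ext (j | j)
    · change pose R p (Sum.inr ()) (Sum.inl j) - (1 : Mat4) (Sum.inr ()) (Sum.inl j) = 0
      simp [pose]
    · change pose R p (Sum.inr ()) (Sum.inr j) - (1 : Mat4) (Sum.inr ()) (Sum.inr j) = 0
      simp [pose]

/-- Near the identity, the innovation controls the pose error. -/
theorem exists_le_norm_innovation (hobs : Observable yo) (hyo : ∀ i, eNorm (yo i) = 1)
    (hk : ∀ i, 0 < k i) : ∃ c > 0, ∀ᶠ E : Mat4 in 𝓝 1, E ∈ SE3 →
      c * ‖E - 1‖ ≤ ‖innovation yo k E yo‖ := by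
  obtain ⟨K, hK, hanti⟩ :=
    (constraintLin yo k).injective_iff_antilipschitz.1 (injective_constraintLin hobs hyo hk)
  obtain ⟨C, hC, hR⟩ := exists_bound_linearMap rotPartLin
  have hKpos : (0 : ℝ) < K := hK
  have hbound : ∀ Z : Mat4, ‖Z‖ ≤ K * ‖constraintLin yo k Z‖ := fun Z => by
    simpa using hanti.le_mul_dist Z 0
  -- With `Z = E - 1`, `2 c ‖Z‖` is at most the norm of the constraint map at `Z`, and each error
  -- term costs at most `(c / 2) ‖Z‖`; enough remains for the constant `c / 2`.
  set c : ℝ := (2 * K)⁻¹ with hc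
  have hcpos : 0 < c := by positivity
  have hKc : K * c = 1 / 2 := by rw [hc]; field_simp
  refine ⟨c / 2, by positivity, ?_⟩
  have hsmall : ∀ᶠ E : Mat4 in 𝓝 1, ‖E - 1‖ < c / 2 / C ^ 2 := by
    have : ContinuousAt (fun E : Mat4 => ‖E - 1‖) 1 :=
      (continuousAt_id.sub continuousAt_const).norm
    refine this.eventually (gt_mem_nhds ?_)
    simp only [sub_self, norm_zero]
    positivity
  filter_upwards [eventually_norm_innovation_sub_le hyo (fun i => (hk i).le) (half_pos hcpos),
    hsmall] with E h1 h2 hE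
  have h3 := hbound (E - 1)
  rw [constraintLin_sub_one hE] at h3
  have h4 : ‖-((rotPart (E - 1))ᵀ * rotPart (E - 1))‖ ≤ c / 2 * ‖E - 1‖ := by
    have h5 : ‖rotPart (E - 1)‖ ≤ C * ‖E - 1‖ := hR (E - 1)
    rw [norm_neg]
    calc _ ≤ ‖(rotPart (E - 1))ᵀ‖ * ‖rotPart (E - 1)‖ := norm_mul_le _ _
      _ = ‖rotPart (E - 1)‖ * ‖rotPart (E - 1)‖ := by rw [Matrix.frobenius_norm_transpose]
      _ ≤ (C * ‖E - 1‖) * (C * ‖E - 1‖) := by gcongr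
      _ = C ^ 2 * ‖E - 1‖ * ‖E - 1‖ := by ring
      _ ≤ C ^ 2 * (c / 2 / C ^ 2) * ‖E - 1‖ := by gcongr
      _ = c / 2 * ‖E - 1‖ := by field_simp
  have h5 : ‖innovationLin yo k (E - 1)‖ ≤ ‖innovation yo k E yo‖ + c / 2 * ‖E - 1‖ := by
    rw [norm_sub_rev] at h1
    linarith [norm_sub_norm_le (innovationLin yo k (E - 1)) (innovation yo k E yo)]
  have h6 : ‖(innovationLin yo k (E - 1), -((rotPart (E - 1))ᵀ * rotPart (E - 1)), (0 : Vec4))‖ ≤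
      ‖innovation yo k E yo‖ + c / 2 * ‖E - 1‖ := by
    rw [norm_prod_le_iff, norm_prod_le_iff, norm_zero]
    exact ⟨h5, h4.trans (by linarith [norm_nonneg (innovation yo k E yo)]), by positivity⟩
  have h7 : c * ‖E - 1‖ ≤ 1 / 2 * (‖innovation yo k E yo‖ + c / 2 * ‖E - 1‖) := by
    calc c * ‖E - 1‖ ≤ c * (K * (‖innovation yo k E yo‖ + c / 2 * ‖E - 1‖)) := by
          gcongr
          exact h3.trans (by gcongr)
      _ = K * c * (‖innovation yo k E yo‖ + c / 2 * ‖E - 1‖) := by ring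
      _ = _ := by rw [hKc]
  nlinarith [norm_nonneg (innovation yo k E yo), mul_nonneg hcpos.le (norm_nonneg (E - 1))]

theorem norm_vecMulVec {u v : Vec4} : ‖Matrix.vecMulVec u v‖ = eNorm u * eNorm v := by
  rw [eNorm, eNorm, ← Real.sqrt_mul (dotProduct_self_nonneg' u), Matrix.frobenius_norm_def,
    ← Real.sqrt_eq_rpow]
  congr 1
  simp only [dotProduct, Finset.sum_mul_sum, Matrix.vecMulVec_apply, Real.norm_eq_abs,
    Real.rpow_two, sq_abs]
  exact Finset.sum_congr rfl fun i _ => Finset.sum_congr rfl fun j _ => by ring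

theorem outErr_dotProduct_le_one {E : Mat4} {y : Vec4} (hE : E *ᵥ y ≠ 0) (hy : eNorm y = 1) :
    outErr E y ⬝ᵥ y ≤ 1 := by
  have h := dotProduct_le_eNorm_mul (outErr E y) y
  have h1 : eNorm (outErr E y) = 1 := by
    rw [eNorm, outErr, normalize_dotProduct_self hE, Real.sqrt_one]
  rwa [h1, hy, one_mul] at h

theorem misalignment_nonneg (hyo : ∀ i, eNorm (yo i) = 1) (hk : ∀ i, 0 ≤ k i) {E : Mat4}
    (hE : ∀ i, E *ᵥ yo i ≠ 0) : 0 ≤ misalignment yo k E :=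
  Finset.sum_nonneg fun i _ => mul_nonneg (hk i)
    (sub_nonneg.2 (outErr_dotProduct_le_one (hE i) (hyo i)))

/-- The squared innovation is controlled by the misalignment. -/
theorem exists_norm_innovation_sq_le (hyo : ∀ i, eNorm (yo i) = 1) (hk : ∀ i, 0 ≤ k i) :
    ∃ C > 0, ∀ E : Mat4, (∀ i, E *ᵥ yo i ≠ 0) →
      ‖innovation yo k E yo‖ ^ 2 ≤ C * misalignment yo k E := by
  obtain ⟨C, hC, hP⟩ := exists_bound_linearMap projSe3Lin
  refine ⟨C ^ 2 * ((∑ i, k i) * 2) + 1, ?_, fun E hE => ?_⟩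
  · have : 0 ≤ ∑ i, k i := Finset.sum_nonneg fun i _ => hk i
    positivity
  let u : Fin N → ℝ := fun i => ‖(1 - Matrix.vecMulVec (outErr E (yo i)) (outErr E (yo i))) *
    Matrix.vecMulVec (yo i) (outErr E (yo i))‖
  -- For unit vectors, `|y - (e ⬝ y) e|² = 1 - (e ⬝ y)² ≤ 2 (1 - e ⬝ y)`.
  have hu : ∀ i, u i ^ 2 ≤ 2 * (1 - outErr E (yo i) ⬝ᵥ yo i) := by
    intro i
    have hle := outErr_dotProduct_le_one (hE i) (hyo i)
    have hee : outErr E (yo i) ⬝ᵥ outErr E (yo i) = 1 := normalize_dotProduct_self (hE i)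
    have hyy : yo i ⬝ᵥ yo i = 1 := by rw [← eNorm_sq, hyo, one_pow]
    have h1 := vecMulVec_conj (outErr E (yo i)) (yo i) 1
    rw [mul_one, Matrix.one_mulVec] at h1
    simp only [u]
    rw [h1, norm_vecMulVec, mul_pow, eNorm_sq, eNorm_sq, hee, mul_one]
    simp only [sub_dotProduct, dotProduct_sub, smul_dotProduct, dotProduct_smul, smul_eq_mul, hee,
      hyy]
    rw [dotProduct_comm (yo i)]
    nlinarith [sq_nonneg (1 - outErr E (yo i) ⬝ᵥ yo i)]
  have h1 : ‖innovation yo k E yo‖ ≤ C * ∑ i, k i * u i := by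
    have e : innovation yo k E yo = -projSe3Lin (∑ i, k i •
      ((1 - Matrix.vecMulVec (outErr E (yo i)) (outErr E (yo i))) *
        Matrix.vecMulVec (yo i) (outErr E (yo i)))) := rfl
    rw [e, norm_neg]
    refine (hP _).trans ?_
    gcongr
    refine (norm_sum_le _ _).trans (Finset.sum_le_sum fun i _ => ?_)
    rw [norm_smul, Real.norm_of_nonneg (hk i)]
  have h2 : (∑ i, k i * u i) ^ 2 ≤ (∑ i, k i) * ∑ i, k i * u i ^ 2 :=
    Finset.sum_sq_le_sum_mul_sum_of_sq_le_mul _ (fun i _ => hk i)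
      (fun i _ => mul_nonneg (hk i) (sq_nonneg _)) fun i _ => by
        rw [mul_pow, sq (k i), mul_assoc]
  have h3 : ∑ i, k i * u i ^ 2 ≤ 2 * misalignment yo k E := by
    rw [misalignment, Finset.mul_sum]
    refine Finset.sum_le_sum fun i _ => ?_
    have := mul_le_mul_of_nonneg_left (hu i) (hk i)
    linarith
  have h4 : 0 ≤ ∑ i, k i := Finset.sum_nonneg fun i _ => hk i
  have h5 := misalignment_nonneg hyo hk hE
  calc ‖innovation yo k E yo‖ ^ 2 ≤ (C * ∑ i, k i * u i) ^ 2 := by gcongr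
    _ = C ^ 2 * (∑ i, k i * u i) ^ 2 := by ring
    _ ≤ C ^ 2 * ((∑ i, k i) * (2 * misalignment yo k E)) := by
      gcongr
      exact h2.trans (by gcongr)
    _ ≤ _ := by linarith

end Coercivity


/-! ### Invariance of `SE(3)`. -/

section Invariance

theorem eq_of_hasDerivWithinAt_zero {V : Type*} [NormedAddCommGroup V] [NormedSpace ℝ V]
    {f : ℝ → V} {a b : ℝ} (hf : ∀ t ∈ Icc a b, HasDerivWithinAt f 0 (Icc a b) t) :
    ∀ t ∈ Icc a b, f t = f a := by
  intro t ht
  have := norm_image_sub_le_of_norm_deriv_le_segment' (C := 0) hf (fun _ _ => by simp) t ht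
  rw [zero_mul, norm_le_zero_iff, sub_eq_zero] at this
  exact this

theorem skew_transpose (a : Vec3) : (skew a)ᵀ = -skew a := by
  ext i j
  fin_cases i <;> fin_cases j <;> simp [skew]

/-- `SE(3)` is invariant under `E' = U E` with `U` valued in `𝔰𝔢(3)`. -/
theorem mem_SE3_of_hasDerivWithinAt {E : ℝ → Mat4} {a c : ℝ → Vec3} {t₀ T : ℝ}
    (hE0 : E t₀ ∈ SE3)
    (hE : ∀ t ∈ Icc t₀ T, HasDerivWithinAt E (twist (a t) (c t) * E t) (Icc t₀ T) t) :
    ∀ t ∈ Icc t₀ T, E t ∈ SE3 := by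
  obtain ⟨R₀, hR₀, p₀, hEp⟩ := hE0
  have hrow : ∀ t ∈ Icc t₀ T, ∀ j, E t (Sum.inr ()) j = pose R₀ p₀ (Sum.inr ()) j := by
    intro t ht j
    have := eq_of_hasDerivWithinAt_zero (f := fun t => E t (Sum.inr ()) j) (fun s hs => by
      refine (HasDerivWithinAt.matrix_entry (hE s hs) (Sum.inr ()) j).congr_deriv ?_
      simp [twist, Matrix.mul_apply]) t ht
    rw [this, hEp]
  have hrot : ∀ t ∈ Icc t₀ T, rotPart (twist (a t) (c t) * E t) = skew (a t) * rotPart (E t) := by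
    intro t ht
    ext i j
    have h0 : E t (Sum.inr ()) (Sum.inl j) = 0 := by rw [hrow t ht]; simp [pose]
    simp [rotPart, Matrix.toBlocks₁₁, twist, Matrix.mul_apply, h0]
  have horth : ∀ t ∈ Icc t₀ T, (rotPart (E t))ᵀ * rotPart (E t) = 1 := by
    intro t ht
    have := eq_of_hasDerivWithinAt_zero (f := fun t => (rotPart (E t))ᵀ * rotPart (E t))
      (fun s hs => by
        have h1 : HasDerivWithinAt (fun t => (rotPart (E t))ᵀ)
            (rotPart (twist (a s) (c s) * E s))ᵀ (Icc t₀ T) s :=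
          (LinearMap.toContinuousLinearMap rotPartTransposeLin).hasFDerivAt.comp_hasDerivWithinAt s
            (hE s hs)
        have h2 : HasDerivWithinAt (fun t => rotPart (E t))
            (rotPart (twist (a s) (c s) * E s)) (Icc t₀ T) s :=
          (LinearMap.toContinuousLinearMap rotPartLin).hasFDerivAt.comp_hasDerivWithinAt s
            (hE s hs)
        refine (h1.mul h2).congr_deriv ?_
        rw [hrot s hs, Matrix.transpose_mul, skew_transpose]
        noncomm_ring) t ht
    rw [this, hEp, rotPart_pose]
    exact (mem_SO_iff.1 hR₀).1
  have hcont : ContinuousOn (fun t => (rotPart (E t)).det) (Icc t₀ T) := by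
    have h1 : Continuous fun M : Mat4 => (rotPart M).det :=
      (LinearMap.continuous_of_finiteDimensional rotPartLin).matrix_det
    exact h1.comp_continuousOn fun t ht => (hE t ht).continuousWithinAt
  have hdetsq : ∀ t ∈ Icc t₀ T, (rotPart (E t)).det * (rotPart (E t)).det = 1 := by
    intro t ht
    have := congrArg Matrix.det (horth t ht)
    rwa [Matrix.det_mul, Matrix.det_transpose, Matrix.det_one] at this
  intro t ht
  -- The determinant is continuous with square 1, so it cannot change sign.
  have hdet : (rotPart (E t)).det = 1 := by
    rcases mul_self_eq_one_iff.1 (hdetsq t ht) with h | h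
    · exact h
    · exfalso
      have h0 : (rotPart (E t₀)).det = 1 := by
        rw [hEp, rotPart_pose]
        exact (mem_SO_iff.1 hR₀).2
      obtain ⟨s, hs, hs0⟩ := intermediate_value_Icc' ht.1
        (hcont.mono (Icc_subset_Icc_right ht.2))
        (show (0 : ℝ) ∈ Icc _ _ from ⟨by simp only [h]; norm_num, by simp only [h0]; norm_num⟩)
      have := hdetsq s ⟨hs.1, hs.2.trans ht.2⟩
      simp only at hs0
      rw [hs0] at this
      norm_num at this
  refine ⟨rotPart (E t), mem_SO_iff.2 ⟨horth t ht, hdet⟩, posPart (E t), ?_⟩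
  ext (i | i) (j | j)
  · rfl
  · rfl
  · rw [hrow t ht]; rfl
  · rw [hrow t ht]; rfl

end Invariance

/-! ### Lyapunov stability and global existence. -/

section Stability

variable {N : ℕ} {yo : Fin N → Vec4} {k : Fin N → ℝ} {kb κΩ κV δΩ δV : ℝ} {bΩ bV : Vec3}
  {X : ℝ → Mat4}

/-- The distance of an error state to the equilibrium. -/
def errDist (z : ErrState) : ℝ := max ‖z.1 - 1‖ ‖twist z.2.1 z.2.2‖

theorem continuous_errDist : Continuous errDist := by
  have h : Continuous fun z : ErrState => twist z.2.1 z.2.2 :=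
    (LinearMap.continuous_of_finiteDimensional twistLin).comp continuous_snd
  exact ((continuous_fst.sub continuous_const).norm).max h.norm

theorem dist_eq_errDist (z : ErrState) :
    dist ((z.1, twist z.2.1 z.2.2) : Mat4 × Mat4) (1, 0) = errDist z := by
  rw [Prod.dist_eq, dist_eq_norm, dist_zero_right]
  rfl

/-- Lipschitz bounds hold on balls of the product metric, stability bounds on balls of `errDist`;
this passes from the latter to the former. -/
theorem dist_le_errDist (z : ErrState) : dist z (1, 0, 0) ≤ errDist z := by
  have h := norm_twist_sq z.2.1 z.2.2
  have hentry : ∀ (u : Vec3) (i : Fin 3), u i ^ 2 ≤ u ⬝ᵥ u := fun u i => by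
    rw [dotProduct, sq]
    exact Finset.single_le_sum (f := fun j => u j * u j) (fun j _ => mul_self_nonneg _)
      (Finset.mem_univ i)
  have h1 := dotProduct_self_nonneg' z.2.1
  have h2 := dotProduct_self_nonneg' z.2.2
  rw [Prod.dist_eq, Prod.dist_eq, dist_eq_norm, dist_zero_right, dist_zero_right]
  refine max_le_max le_rfl (max_le ?_ ?_)
  · refine (pi_norm_le_iff_of_nonneg (norm_nonneg _)).2 fun i => ?_
    rw [Real.norm_eq_abs]
    refine abs_le_of_sq_le_sq ?_ (norm_nonneg _)
    linarith [hentry z.2.1 i]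
  · refine (pi_norm_le_iff_of_nonneg (norm_nonneg _)).2 fun i => ?_
    rw [Real.norm_eq_abs]
    refine abs_le_of_sq_le_sq ?_ (norm_nonneg _)
    linarith [hentry z.2.2 i]

theorem IsErrSolution.mono {J J' : Set ℝ} {z : ℝ → ErrState}
    (hz : IsErrSolution yo k kb κΩ κV δΩ δV bΩ bV X J z) (h : J' ⊆ J) :
    IsErrSolution yo k kb κΩ κV δΩ δV bΩ bV X J' z :=
  fun t ht => ⟨(hz t (h ht)).1, (hz t (h ht)).2.mono h⟩

theorem IsErrSolution.continuousOn {J : Set ℝ} {z : ℝ → ErrState}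
    (hz : IsErrSolution yo k kb κΩ κV δΩ δV bΩ bV X J z) : ContinuousOn z J :=
  fun t ht => (hz t ht).2.continuousWithinAt

/-- Near the identity, innovation and misalignment bound the pose error from above. -/
theorem exists_coercive (hobs : Observable yo) (hyo : ∀ i, eNorm (yo i) = 1)
    (hk : ∀ i, 0 < k i) : ∃ r > 0, ∃ c > 0, (∀ E : Mat4, dist E 1 ≤ r → ∀ i, E *ᵥ yo i ≠ 0) ∧
      ∀ E ∈ SE3, ‖E - 1‖ ≤ r → c * ‖E - 1‖ ^ 2 ≤ ‖innovation yo k E yo‖ ^ 2 ∧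
        c * ‖E - 1‖ ^ 2 ≤ misalignment yo k E := by
  obtain ⟨c, hc, h⟩ := exists_le_norm_innovation hobs hyo hk
  obtain ⟨C, hC, hmis⟩ := exists_norm_innovation_sq_le (k := k) hyo fun i => (hk i).le
  obtain ⟨r₁, hr₁, hball⟩ := exists_ball_mulVec_ne_zero fun i => ne_zero_of_eNorm_eq_one (hyo i)
  obtain ⟨r₂, hr₂, h⟩ := Metric.nhds_basis_closedBall.eventually_iff.1 h
  refine ⟨min r₁ r₂, lt_min hr₁ hr₂, min (c ^ 2) (c ^ 2 / C), by positivity,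
    fun E hE => hball E (hE.trans (min_le_left _ _)), fun E hE hEr => ?_⟩
  have h1 := h (x := E) (by
    rw [Metric.mem_closedBall, dist_eq_norm]
    exact hEr.trans (min_le_right _ _)) hE
  have h2 : c ^ 2 * ‖E - 1‖ ^ 2 ≤ ‖innovation yo k E yo‖ ^ 2 := by
    rw [← mul_pow]
    gcongr
  have h3 := hmis E fun i =>
    mulVec_ne_zero_of_mem_SE3 hE (ne_zero_of_eNorm_eq_one (hyo i))
  constructor
  · refine le_trans ?_ h2
    gcongr
    exact min_le_left _ _
  · calc _ ≤ c ^ 2 / C * ‖E - 1‖ ^ 2 := by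
          gcongr
          exact min_le_right _ _
      _ = c ^ 2 * ‖E - 1‖ ^ 2 / C := by ring
      _ ≤ misalignment yo k E := by
        rw [div_le_iff₀ hC]
        linarith

theorem misalignment_one (hyo : ∀ i, eNorm (yo i) = 1) : misalignment yo k 1 = 0 := by
  simp [misalignment, outErr_one (hyo _), ← eNorm_sq, hyo]

theorem continuousAt_misalignment (hyo : ∀ i, eNorm (yo i) = 1) :
    ContinuousAt (misalignment yo k) 1 := by
  refine tendsto_finsetSum _ fun i _ => ?_
  have hne : (1 : Mat4) *ᵥ yo i ≠ 0 := by
    rw [Matrix.one_mulVec]; exact ne_zero_of_eNorm_eq_one (hyo i)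
  have he := contDiffAt_dotProduct (contDiffAt_outErr contDiffAt_id hne)
    (contDiffAt_const (c := yo i))
  exact continuousAt_const.mul (continuousAt_const.sub he.continuousAt)

/-- Lyapunov stability of the error dynamics. -/
theorem IsErrSolution.stable (hobs : Observable yo) (hyo : ∀ i, eNorm (yo i) = 1)
    (hk : ∀ i, 0 < k i) (hkb : 0 < kb) (hκΩ : 0 ≤ κΩ) (hκV : 0 ≤ κV)
    (hbΩ : eNorm bΩ ≤ δΩ) (hbV : eNorm bV ≤ δV) {ε : ℝ} (hε : 0 < ε) :
    ∃ δ > 0, ∀ (t₀ T : ℝ) (z : ℝ → ErrState), t₀ ≤ T →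
      IsErrSolution yo k kb κΩ κV δΩ δV bΩ bV X (Icc t₀ T) z → errDist (z t₀) < δ →
        ∀ t ∈ Icc t₀ T, errDist (z t) < ε := by
  obtain ⟨r, hr, c, hc, -, hcoer⟩ := exists_coercive (k := k) hobs hyo hk
  have hy0 : ∀ i, yo i ≠ 0 := fun i => ne_zero_of_eNorm_eq_one (hyo i)
  set ρ := min ε r with hρ
  have hρ0 : 0 < ρ := lt_min hε hr
  -- While the coercivity estimate applies, `lyapunov < m` forces both components of `errDist` below
  -- `ρ`.
  set m := min (c * ρ ^ 2) ((2 * kb)⁻¹ * ρ ^ 2) with hm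
  have hm0 : 0 < m := by positivity
  have hmis0 : misalignment yo k 1 < m / 2 := by rw [misalignment_one hyo]; positivity
  obtain ⟨δ₁, hδ₁, hmis⟩ := Metric.eventually_nhds_iff.1
    ((continuousAt_misalignment (k := k) hyo).eventually (gt_mem_nhds hmis0))
  have hs0 : 0 < √(kb * m) := Real.sqrt_pos.2 (by positivity)
  -- The first two bounds keep each half of the initial Lyapunov value below `m / 2`. The third
  -- starts the bootstrap, needed because coercivity holds only for `‖E - 1‖ ≤ r`.
  refine ⟨min (min δ₁ √(kb * m)) ρ, lt_min (lt_min hδ₁ hs0) hρ0,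
    fun t₀ T z hT hz hz0 t ht => ?_⟩
  have hE0 : ‖(z t₀).1 - 1‖ < δ₁ :=
    (le_max_left _ _).trans_lt (hz0.trans_le ((min_le_left _ _).trans (min_le_left _ _)))
  have hb0 : ‖twist (z t₀).2.1 (z t₀).2.2‖ < √(kb * m) :=
    (le_max_right _ _).trans_lt (hz0.trans_le ((min_le_left _ _).trans (min_le_right _ _)))
  have hL0 : lyapunov yo k kb (z t₀) < m := by
    have h1 := hmis (y := (z t₀).1) (by rwa [dist_eq_norm])
    have h2 : ‖twist (z t₀).2.1 (z t₀).2.2‖ ^ 2 < kb * m := by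
      rw [← Real.sq_sqrt (by positivity : 0 ≤ kb * m)]
      gcongr
    have h3 : (2 * kb)⁻¹ * ‖twist (z t₀).2.1 (z t₀).2.2‖ ^ 2 ≤ (2 * kb)⁻¹ * (kb * m) := by
      gcongr
    have h4 : (2 * kb)⁻¹ * (kb * m) = m / 2 := by field_simp
    unfold lyapunov
    linarith
  obtain ⟨d, hd⟩ := hz.exists_hasDerivWithinAt_lyapunov hy0 hkb hκΩ hκV hbΩ hbV
  have hdec : ∀ s ∈ Icc t₀ T, lyapunov yo k kb (z s) < m := by
    intro s hs
    have := sub_le_of_hasDerivWithinAt_le (m := 0) hs.1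
      (fun u hu => ((hd u ⟨hu.1, hu.2.trans hs.2⟩).1.mono (Icc_subset_Icc_right hs.2)))
      (fun u hu => (hd u ⟨hu.1, hu.2.trans hs.2⟩).2.trans (neg_nonpos.2 (sq_nonneg _)))
    linarith
  refine (forall_lt_of_bootstrap (φ := fun s => errDist (z s)) (r := ρ)
    (continuous_errDist.comp_continuousOn hz.continuousOn)
    (hz0.trans_le (min_le_right _ _)) (fun s hs hball => ?_) t ht).trans_le (min_le_left _ _)
  have hmem := (hz s hs).1
  have hEs : ‖(z s).1 - 1‖ ≤ r :=
    (le_max_left _ _).trans ((hball s ⟨hs.1, le_rfl⟩).trans (min_le_right _ _))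
  have h1 := (hcoer _ hmem hEs).2
  have h2 := hdec s hs
  have h3 := misalignment_nonneg hyo (fun i => (hk i).le)
    (fun i => mulVec_ne_zero_of_mem_SE3 hmem (hy0 i))
  have h4 : 0 ≤ (2 * kb)⁻¹ * ‖twist (z s).2.1 (z s).2.2‖ ^ 2 := by positivity
  unfold lyapunov at h2
  refine max_lt ?_ ?_
  · refine lt_of_pow_lt_pow_left₀ 2 hρ0.le (lt_of_mul_lt_mul_left ?_ hc.le)
    linarith [min_le_left (c * ρ ^ 2) ((2 * kb)⁻¹ * ρ ^ 2)]
  · refine lt_of_pow_lt_pow_left₀ 2 hρ0.le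
      (lt_of_mul_lt_mul_left ?_ (by positivity : 0 ≤ (2 * kb)⁻¹))
    linarith [min_le_right (c * ρ ^ 2) ((2 * kb)⁻¹ * ρ ^ 2)]

/-- On a ball around the equilibrium, the error field is bounded. -/
theorem exists_norm_errField_le (hδΩ : 0 ≤ δΩ) (hδV : 0 ≤ δV) {r : ℝ}
    (hr : ∀ E : Mat4, dist E 1 ≤ r → ∀ i, E *ᵥ yo i ≠ 0) (C : ℝ) :
    ∃ M : ℝ≥0, ∀ X : Mat4, ‖X‖ ≤ C → ∀ z : ErrState, dist z (1, 0, 0) ≤ r →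
      ‖errField yo k kb κΩ κV δΩ δV bΩ bV X z‖ ≤ M := by
  obtain ⟨K, hK⟩ := exists_lipschitzOnWith_errField (k := k) (kb := kb) (κΩ := κΩ) (κV := κV)
    (bΩ := bΩ) (bV := bV) hδΩ hδV hr C
  obtain ⟨M, hM⟩ := ((isCompact_closedBall (0 : Mat4) C).prod
    (isCompact_closedBall ((1, 0, 0) : ErrState) r)).exists_bound_of_continuousOn hK.continuousOn
  refine ⟨⟨max M 0, le_max_right _ _⟩, fun X hX z hz => ?_⟩
  exact (hM (X, z) ⟨by simpa using hX, hz⟩).trans (le_max_left _ _)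

/-- Solutions of the error dynamics that start near the equilibrium exist for all times. -/
theorem exists_isErrSolution (hobs : Observable yo) (hyo : ∀ i, eNorm (yo i) = 1)
    (hk : ∀ i, 0 < k i) (hkb : 0 < kb) (hκΩ : 0 ≤ κΩ) (hκV : 0 ≤ κV)
    (hδΩ : 0 ≤ δΩ) (hδV : 0 ≤ δV) (hbΩ : eNorm bΩ ≤ δΩ) (hbV : eNorm bV ≤ δV)
    (hX_cont : ContinuousOn X (Ici 0)) (hX_bdd : ∃ C : ℝ, ∀ t, 0 ≤ t → ‖X t‖ ≤ C) :
    ∃ δ > 0, ∀ t₀ : ℝ, 0 ≤ t₀ → ∀ z₀ : ErrState, z₀.1 ∈ SE3 → errDist z₀ < δ →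
      ∃ z : ℝ → ErrState, z t₀ = z₀ ∧
        IsErrSolution yo k kb κΩ κV δΩ δV bΩ bV X (Ici t₀) z := by
  obtain ⟨r, hr, hball⟩ := exists_ball_mulVec_ne_zero fun i => ne_zero_of_eNorm_eq_one (hyo i)
  obtain ⟨C, hC⟩ := hX_bdd
  obtain ⟨K, hK⟩ := exists_lipschitzOnWith_errField (k := k) (kb := kb) (κΩ := κΩ) (κV := κV)
    (bΩ := bΩ) (bV := bV) hδΩ hδV hball C
  obtain ⟨M, hM⟩ := exists_norm_errField_le (k := k) (kb := kb) (κΩ := κΩ) (κV := κV)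
    (bΩ := bΩ) (bV := bV) hδΩ hδV hball C
  obtain ⟨δ, hδ, hstab⟩ := IsErrSolution.stable (X := X) hobs hyo hk hkb hκΩ hκV hbΩ hbV hr
  refine ⟨min δ r, lt_min hδ hr, fun t₀ ht₀ z₀ hz₀ hz₀δ => ?_⟩
  obtain ⟨z, hz0, hzc, hz⟩ := exists_solution_of_lipschitzOnWith hr.le hK
    (fun X hX z hz => hM X (by simpa using hX) z hz) (hX_cont.mono (Ici_subset_Ici.2 ht₀))
    (fun t ht => by simpa using hC t (ht₀.trans ht)) z₀
  -- As long as the curve stays in the ball it solves the true equation, and so remains in `SE(3)`.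
  -- Stability then keeps it strictly inside, which closes the bootstrap.
  have hsol : ∀ s, (∀ u ∈ Icc t₀ s, errDist (z u) ≤ r) →
      IsErrSolution yo k kb κΩ κV δΩ δV bΩ bV X (Icc t₀ s) z := by
    intro s hs
    have hder : ∀ t ∈ Icc t₀ s, HasDerivWithinAt z
        (errField yo k kb κΩ κV δΩ δV bΩ bV (X t) (z t)) (Icc t₀ s) t := by
      intro t ht
      exact (hz t ht.1 ((dist_le_errDist _).trans (hs t ht))).mono Icc_subset_Ici_self
    have hmem := mem_SE3_of_hasDerivWithinAt (E := fun t => (z t).1) (by rwa [hz0])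
      (fun t ht => HasDerivWithinAt.fst_fun (hder t ht))
    exact fun t ht => ⟨hmem t ht, hder t ht⟩
  have hstay : ∀ T, t₀ ≤ T → ∀ t ∈ Icc t₀ T, errDist (z t) < r := by
    intro T hT
    refine forall_lt_of_bootstrap (φ := fun s => errDist (z s))
      (continuous_errDist.comp_continuousOn (hzc.mono Icc_subset_Ici_self)) ?_ (fun s hs hs' => ?_)
    · rw [hz0]
      exact hz₀δ.trans_le (min_le_right _ _)
    · refine hstab t₀ s z hs.1 (hsol s hs') ?_ s ⟨hs.1, le_rfl⟩
      rw [hz0]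
      exact hz₀δ.trans_le (min_le_left _ _)
  refine ⟨z, hz0, fun t ht => ⟨?_, ?_⟩⟩
  · exact (hsol t (fun u hu => (hstay t ht u hu).le) t ⟨ht, le_rfl⟩).1
  · exact hz t ht ((dist_le_errDist _).trans (hstay t ht t ⟨ht, le_rfl⟩).le)

end Stability


/-! ### Convergence of the pose error and of the bias error. -/

section Attractivity

variable {N : ℕ} {yo : Fin N → Vec4} {k : Fin N → ℝ} {kb κΩ κV δΩ δV : ℝ} {bΩ bV : Vec3}
  {X : ℝ → Mat4}

/-- The determinant is 1, so inversion is polynomial on `SE(3)` and bounded on bounded subsets. -/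
theorem inv_eq_adjugate_of_mem_SE3 {X : Mat4} (hX : X ∈ SE3) : X⁻¹ = X.adjugate := by
  obtain ⟨R, hR, p, rfl⟩ := hX
  have hdet : (pose R p).det = 1 := by
    rw [pose, Matrix.det_fromBlocks_zero₂₁, (mem_SO_iff.1 hR).2, Matrix.det_one, one_mul]
  rw [Matrix.inv_def, hdet, Ring.inverse_one, one_smul]

theorem exists_norm_inv_le (C : ℝ) : ∃ C' : ℝ, 0 < C' ∧ ∀ X ∈ SE3, ‖X‖ ≤ C → ‖X⁻¹‖ ≤ C' := by
  have hc : Continuous fun X : Mat4 => X.adjugate := continuous_id.matrix_adjugate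
  obtain ⟨M, hM⟩ := (isCompact_closedBall (0 : Mat4) C).exists_bound_of_continuousOn hc.continuousOn
  refine ⟨max M 1, by positivity, fun X hX hXC => ?_⟩
  rw [inv_eq_adjugate_of_mem_SE3 hX]
  exact (hM X (by simpa using hXC)).trans (le_max_left _ _)

theorem continuousAt_innovation (hyo : ∀ i, eNorm (yo i) = 1) :
    ContinuousAt (fun E => innovation yo k E yo) 1 := by
  have hne : ∀ i, (1 : Mat4) *ᵥ yo i ≠ 0 := fun i => by
    rw [Matrix.one_mulVec]; exact ne_zero_of_eNorm_eq_one (hyo i)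
  simp only [innovation_eq_twist, ← twistLin_apply]
  exact (contDiffAt_linearMap_comp twistLin
    ((contDiffAt_innovOmega (k := k) contDiffAt_id hne).prodMk
      (contDiffAt_innovV (k := k) contDiffAt_id hne))).continuousAt

theorem innovation_one (hyo : ∀ i, eNorm (yo i) = 1) : innovation yo k 1 yo = 0 := by
  rw [innovation_eq_twist, innovOmega_one k hyo, innovV_one k hyo, twist_zero]

theorem norm_mul_three_le (A B D : Mat4) : ‖A * B * D‖ ≤ ‖A‖ * ‖B‖ * ‖D‖ :=
  (norm_mul_le _ _).trans (by gcongr; exact norm_mul_le _ _)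

/-- Attractivity of the equilibrium of the error dynamics. -/
theorem IsErrSolution.attractive (hobs : Observable yo) (hyo : ∀ i, eNorm (yo i) = 1)
    (hk : ∀ i, 0 < k i) (hkb : 0 < kb) (hκΩ : 0 ≤ κΩ) (hκV : 0 ≤ κV)
    (hδΩ : 0 ≤ δΩ) (hδV : 0 ≤ δV) (hbΩ : eNorm bΩ ≤ δΩ) (hbV : eNorm bV ≤ δV)
    {A : ℝ → Mat4} (hA_bdd : ∃ C : ℝ, ∀ t, 0 ≤ t → ‖A t‖ ≤ C)
    (hX_mem : ∀ t, 0 ≤ t → X t ∈ SE3)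
    (hX_ode : ∀ t, 0 ≤ t → HasDerivWithinAt X (X t * A t) (Ici 0) t)
    (hX_bdd : ∃ C : ℝ, ∀ t, 0 ≤ t → ‖X t‖ ≤ C) :
    ∃ δ > 0, ∀ t₀ : ℝ, 0 ≤ t₀ → ∀ z : ℝ → ErrState,
      IsErrSolution yo k kb κΩ κV δΩ δV bΩ bV X (Ici t₀) z → errDist (z t₀) < δ →
        Tendsto (fun t => (z t).1) atTop (𝓝 1) ∧
          Tendsto (fun t => twist (z t).2.1 (z t).2.2) atTop (𝓝 0) := by
  obtain ⟨r, hr, c, hc, hball, hcoer⟩ := exists_coercive (k := k) hobs hyo hk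
  have hy0 : ∀ i, yo i ≠ 0 := fun i => ne_zero_of_eNorm_eq_one (hyo i)
  obtain ⟨δ, hδ, hstab⟩ := IsErrSolution.stable (X := X) hobs hyo hk hkb hκΩ hκV hbΩ hbV hr
  obtain ⟨CA, hCA⟩ := hA_bdd
  obtain ⟨CX, hCX⟩ := hX_bdd
  obtain ⟨CI, hCI0, hCI⟩ := exists_norm_inv_le CX
  obtain ⟨M, hM⟩ := exists_norm_errField_le (k := k) (kb := kb) (κΩ := κΩ) (κV := κV)
    (bΩ := bΩ) (bV := bV) hδΩ hδV hball CX
  obtain ⟨CT, hCT0, hCT⟩ := exists_bound_linearMap twistLin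
  have hCA0 : 0 ≤ CA := (norm_nonneg _).trans (hCA 0 le_rfl)
  have hCX0 : 0 ≤ CX := (norm_nonneg _).trans (hCX 0 le_rfl)
  refine ⟨δ, hδ, fun t₀ ht₀ z hz hz0 => ?_⟩
  have hdist : ∀ t ∈ Ici t₀, errDist (z t) < r := fun t ht =>
    hstab t₀ t z ht (hz.mono Icc_subset_Ici_self) hz0 t ⟨ht, le_rfl⟩
  have hfield : ∀ t ∈ Ici t₀, ‖errField yo k kb κΩ κV δΩ δV bΩ bV (X t) (z t)‖ ≤ M :=
    fun t ht => hM _ (hCX t (ht₀.trans ht)) _ ((dist_le_errDist _).trans (hdist t ht).le)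
  have hzlip : ∀ s t, t₀ ≤ s → s ≤ t → ‖(z t).1 - (z s).1‖ ≤ M * (t - s) := by
    intro s t hs hst
    have := norm_image_sub_le_of_norm_deriv_le_segment' (f := z) (C := M)
      (fun u hu => (hz u (hs.trans hu.1)).2.mono fun v hv => hs.trans hv.1)
      (fun u hu => hfield u (hs.trans hu.1)) t ⟨hst, le_rfl⟩
    exact (norm_fst_le (z t - z s)).trans this
  obtain ⟨d, hd⟩ := hz.exists_hasDerivWithinAt_lyapunov hy0 hkb hκΩ hκV hbΩ hbV
  have hE : Tendsto (fun t => ‖(z t).1 - 1‖) atTop (𝓝 0) := by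
    refine tendsto_zero_of_dissipation hc M.2 (fun t ht => (hd t ht).1) (fun t ht => ?_)
      (fun t _ => norm_nonneg _) (fun t ht => ?_) (fun s t hs hst => ?_)
    · have h1 := misalignment_nonneg (k := k) hyo (fun i => (hk i).le)
        (fun i => mulVec_ne_zero_of_mem_SE3 (hz t ht).1 (hy0 i))
      unfold lyapunov
      positivity
    · refine (hd t ht).2.trans (neg_le_neg ?_)
      exact (hcoer _ (hz t ht).1 ((le_max_left _ _).trans (hdist t ht).le)).1
    · refine (abs_norm_sub_norm_le _ _).trans ?_
      rw [sub_sub_sub_cancel_right]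
      exact hzlip s t hs hst
  have hE0 : Tendsto (fun t => (z t).1 - 1) atTop (𝓝 0) := tendsto_zero_iff_norm_tendsto_zero.2 hE
  have hE1 : Tendsto (fun t => (z t).1) atTop (𝓝 1) := by
    simpa using hE0.add_const 1
  refine ⟨hE1, ?_⟩
  let B : ℝ → Mat4 := fun t => twist (z t).2.1 (z t).2.2
  -- The bias error seen in the fixed frame: `E' = E q - Δ E`, hence `(E - 1)' = q + ρ` with `ρ = (E
  -- - 1) q - Δ E → 0`.
  let q : ℝ → Mat4 := fun t => X t * B t * (X t)⁻¹
  have hB : ∀ t ∈ Ici t₀, ‖B t‖ ≤ r := fun t ht => (le_max_right _ _).trans (hdist t ht).le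
  have hXi : ∀ t ∈ Ici t₀, ‖(X t)⁻¹‖ ≤ CI := fun t ht =>
    hCI _ (hX_mem t (ht₀.trans ht)) (hCX t (ht₀.trans ht))
  have hXb : ∀ t ∈ Ici t₀, ‖X t‖ ≤ CX := fun t ht => hCX t (ht₀.trans ht)
  have hAb : ∀ t ∈ Ici t₀, ‖A t‖ ≤ CA := fun t ht => hCA t (ht₀.trans ht)
  have hq_bdd : ∀ t ∈ Ici t₀, ‖q t‖ ≤ CX * r * CI := by
    intro t ht
    refine (norm_mul_three_le _ _ _).trans ?_
    gcongr
    · exact hXb t ht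
    · exact hB t ht
    · exact hXi t ht
  -- Differentiating the conjugation by `X` produces the commutator of `A` and `B`; this is where
  -- the bound on `A` enters.
  let q' : ℝ → Mat4 := fun t => X t * (A t * B t - B t * A t +
    twistLin (errField yo k kb κΩ κV δΩ δV bΩ bV (X t) (z t)).2) * (X t)⁻¹
  have hq_der : ∀ t ∈ Ici t₀, HasDerivWithinAt q (q' t) (Ici t₀) t := by
    intro t ht
    have hXm := hX_mem t (ht₀.trans ht)
    have hXd := (hX_ode t (ht₀.trans ht)).mono (Ici_subset_Ici.2 ht₀)
    have hBd : HasDerivWithinAt B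
        (twistLin (errField yo k kb κΩ κV δΩ δV bΩ bV (X t) (z t)).2) (Ici t₀) t :=
      (LinearMap.toContinuousLinearMap twistLin).hasFDerivAt.comp_hasDerivWithinAt t
        (HasDerivWithinAt.snd_fun (hz t ht).2)
    refine ((hXd.mul hBd).mul
      (HasDerivWithinAt.matrix_inv hXd (isUnit_of_mem_SE3 hXm))).congr_deriv ?_
    have h1 : (X t)⁻¹ * (X t * A t) * (X t)⁻¹ = A t * (X t)⁻¹ := by
      rw [← mul_assoc, inv_mul_of_mem_SE3 hXm, one_mul]
    rw [h1, Pi.mul_apply]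
    simp only [q']
    noncomm_ring
  have hq'_bdd : ∀ t ∈ Ici t₀, ‖q' t‖ ≤ CX * (CA * r + r * CA + CT * M) * CI := by
    intro t ht
    refine (norm_mul_three_le _ _ _).trans ?_
    have h1 : ‖A t * B t - B t * A t + twistLin
        (errField yo k kb κΩ κV δΩ δV bΩ bV (X t) (z t)).2‖ ≤ CA * r + r * CA + CT * M := by
      refine (norm_add_le _ _).trans (add_le_add ((norm_sub_le _ _).trans (add_le_add ?_ ?_)) ?_)
      · exact (norm_mul_le _ _).trans
          (mul_le_mul (hAb t ht) (hB t ht) (norm_nonneg _) hCA0)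
      · exact (norm_mul_le _ _).trans
          (mul_le_mul (hB t ht) (hAb t ht) (norm_nonneg _) hr.le)
      · refine (hCT _).trans ?_
        gcongr
        exact (norm_snd_le _).trans (hfield t ht)
    gcongr
    · exact hXb t ht
    · exact hXi t ht
  have hq_lip : ∀ s t, t₀ ≤ s → s ≤ t →
      ‖q t - q s‖ ≤ CX * (CA * r + r * CA + CT * M) * CI * (t - s) := by
    intro s t hs hst
    exact norm_image_sub_le_of_norm_deriv_le_segment'
      (fun u hu => (hq_der u (hs.trans hu.1)).mono fun v hv => hs.trans hv.1)
      (fun u hu => hq'_bdd u (hs.trans hu.1)) t ⟨hst, le_rfl⟩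
  let ρ : ℝ → Mat4 := fun t => ((z t).1 - 1) * q t - innovation yo k (z t).1 yo * (z t).1
  have hZ_der : ∀ t ∈ Ici t₀,
      HasDerivWithinAt (fun t => (z t).1 - 1) (q t + ρ t) (Ici t₀) t := by
    intro t ht
    have hXm := hX_mem t (ht₀.trans ht)
    refine ((HasDerivWithinAt.fst_fun (hz t ht).2).sub_const 1).congr_deriv ?_
    have h1 := errVelocity_mul (yo := yo) (k := k) (mul_mem_SE3 (hz t ht).1 hXm) (z t)
    have h2 : errVelocity yo k ((z t).1 * X t) (z t) * (z t).1 =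
        errVelocity yo k ((z t).1 * X t) (z t) * ((z t).1 * X t) * (X t)⁻¹ := by
      rw [mul_assoc, mul_assoc, mul_inv_of_mem_SE3 hXm, mul_one]
    have h3 : innovation yo k (z t).1 yo * ((z t).1 * X t) * (X t)⁻¹ =
        innovation yo k (z t).1 yo * (z t).1 := by
      rw [mul_assoc, mul_assoc, mul_inv_of_mem_SE3 hXm, mul_one]
    change errVelocity yo k ((z t).1 * X t) (z t) * (z t).1 = _
    rw [h2, h1, sub_mul, h3]
    simp only [ρ, q, B]
    noncomm_ring
  have hρ : Tendsto ρ atTop (𝓝 0) := by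
    have h1 : Tendsto (fun t => ((z t).1 - 1) * q t) atTop (𝓝 0) := by
      refine squeeze_zero_norm' (a := fun t => ‖(z t).1 - 1‖ * (CX * r * CI)) ?_ ?_
      · filter_upwards [eventually_ge_atTop t₀] with t ht
        refine (norm_mul_le _ _).trans ?_
        gcongr
        exact hq_bdd t ht
      · simpa using hE.mul_const (CX * r * CI)
    have h2 : Tendsto (fun t => innovation yo k (z t).1 yo * (z t).1) atTop (𝓝 (0 * 1)) := by
      have h3 := (continuousAt_innovation (k := k) hyo).tendsto.comp hE1
      rw [innovation_one hyo] at h3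
      exact h3.mul hE1
    simpa using h1.sub h2
  have hq0 : Tendsto q atTop (𝓝 0) :=
    tendsto_zero_of_deriv_lipschitz (by positivity) hZ_der hE0 hρ hq_lip
  refine squeeze_zero_norm' (a := fun t => CI * ‖q t‖ * CX) ?_ ?_
  · filter_upwards [eventually_ge_atTop t₀] with t ht
    have hXm := hX_mem t (ht₀.trans ht)
    have h1 : B t = (X t)⁻¹ * q t * X t := by
      simp only [q]
      rw [mul_assoc, mul_assoc, inv_mul_of_mem_SE3 hXm, mul_one, ← mul_assoc,
        inv_mul_of_mem_SE3 hXm, one_mul]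
    change ‖B t‖ ≤ _
    rw [h1]
    refine (norm_mul_three_le _ _ _).trans ?_
    gcongr
    · exact hXi t ht
    · exact hXb t ht
  · simpa using ((tendsto_zero_iff_norm_tendsto_zero.1 hq0).const_mul CI).mul_const CX

end Attractivity

/-! ### The equilibrium and the conclusion for the observer. -/

theorem isErrorMotion_equilibrium {N : ℕ} {yo : Fin N → Vec4} (hyo : ∀ i, eNorm (yo i) = 1)
    (k : Fin N → ℝ) {kb κΩ κV δΩ δV : ℝ} {bΩ bV : Vec3} (hbΩ : eNorm bΩ ≤ δΩ)
    (hbV : eNorm bV ≤ δV) {A X : ℝ → Mat4} {J : Set ℝ} (hX_mem : ∀ t ∈ J, X t ∈ SE3)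
    (hX_ode : ∀ t ∈ J, HasDerivWithinAt X (X t * A t) J t) :
    IsErrorMotion yo k kb κΩ κV δΩ δV A X bΩ bV J (fun _ => (1, 0)) := by
  have h := IsErrSolution.isErrorMotion (yo := yo) (k := k) (kb := kb) (κΩ := κΩ) (κV := κV)
    (δΩ := δΩ) (δV := δV) (bΩ := bΩ) (bV := bV) (z := fun _ => (1, 0, 0))
    (fun i => ne_zero_of_eNorm_eq_one (hyo i)) hX_mem hX_ode fun t _ => ⟨one_mem_SE3, ?_⟩
  · simpa only [twist_zero] using h
  · refine (hasDerivWithinAt_const t J ((1, 0, 0) : ErrState)).congr_deriv ?_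
    -- The true biases are fixed by the saturations, so the anti-windup terms vanish together with
    -- the innovation.
    simp [errField, biasField, errVelocity, innovOmega_one k hyo, innovV_one k hyo, twist_zero,
      sat_of_eNorm_le hbΩ, sat_of_eNorm_le hbV]
    rfl

end PoseObserver

end

theorem corollary1 {N : ℕ}
    (yo : Fin N → PoseObserver.Vec4) (hyo : ∀ i, PoseObserver.eNorm (yo i) = 1)
    (k : Fin N → ℝ) (hk : ∀ i, 0 < k i)
    (kb κΩ κV δΩ δV : ℝ) (hkb : 0 < kb) (hκΩ : 0 < κΩ) (hκV : 0 < κV)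
    (hδΩ : 0 < δΩ) (hδV : 0 < δV)
    (hobs : PoseObserver.Observable yo)
    (hG : IsUnit (PoseObserver.matG yo k)) (hH : IsUnit (PoseObserver.matH yo k))
    (A X : ℝ → PoseObserver.Mat4)
    (hA_mem : ∀ t, 0 ≤ t → A t ∈ PoseObserver.se3) (hA_cont : ContinuousOn A (Ici 0))
    (hA_bdd : ∃ C : ℝ, ∀ t, 0 ≤ t → ‖A t‖ ≤ C)
    (hX_mem : ∀ t, 0 ≤ t → X t ∈ PoseObserver.SE3)
    (hX_ode : ∀ t, 0 ≤ t → HasDerivWithinAt X (X t * A t) (Ici 0) t)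
    (hX_bdd : ∃ C : ℝ, ∀ t, 0 ≤ t → ‖X t‖ ≤ C)
    (bΩ bV : PoseObserver.Vec3)
    (hbΩ : PoseObserver.eNorm bΩ ≤ δΩ) (hbV : PoseObserver.eNorm bV ≤ δV) :
    PoseObserver.LocallyAsymptoticallyStable (PoseObserver.SE3 ×ˢ PoseObserver.se3)
      (PoseObserver.IsErrorMotion yo k kb κΩ κV δΩ δV A X bΩ bV)
      ((1, 0) : PoseObserver.Mat4 × PoseObserver.Mat4) := by
  open PoseObserver in
  have hy0 : ∀ i, yo i ≠ 0 := fun i => ne_zero_of_eNorm_eq_one (hyo i)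
  have hmem : ∀ t₀ : ℝ, 0 ≤ t₀ → ∀ t ∈ Ici t₀, X t ∈ SE3 := fun t₀ ht₀ t ht =>
    hX_mem t (ht₀.trans ht)
  have hode : ∀ t₀ : ℝ, 0 ≤ t₀ → ∀ t ∈ Ici t₀, HasDerivWithinAt X (X t * A t) (Ici t₀) t :=
    fun t₀ ht₀ t ht => (hX_ode t (ht₀.trans ht)).mono (Ici_subset_Ici.2 ht₀)
  refine ⟨⟨one_mem_SE3, 0, 0, twist_zero.symm⟩, fun t₀ ht₀ =>
    isErrorMotion_equilibrium hyo k hbΩ hbV (hmem t₀ ht₀) (hode t₀ ht₀), fun t₀ ht₀ => ?_,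
    fun t₀ ht₀ ε hε => ?_, fun t₀ ht₀ => ?_⟩
  · obtain ⟨δ, hδ, h⟩ := exists_isErrSolution (X := X) (κΩ := κΩ) (κV := κV) hobs hyo hk hkb
      hκΩ.le hκV.le hδΩ.le hδV.le hbΩ hbV (fun t ht => (hX_ode t ht).continuousWithinAt) hX_bdd
    refine ⟨δ, hδ, ?_⟩
    rintro ⟨E₀, _⟩ ⟨hE₀, w, v, rfl⟩ hdist
    rw [dist_eq_errDist (E₀, w, v)] at hdist
    obtain ⟨z, hz0, hz⟩ := h t₀ ht₀ (E₀, w, v) hE₀ hdist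
    exact ⟨_, hz.isErrorMotion hy0 (hmem t₀ ht₀) (hode t₀ ht₀), by simp only [hz0]⟩
  · obtain ⟨δ, hδ, h⟩ := IsErrSolution.stable (X := X) (κΩ := κΩ) (κV := κV) hobs hyo hk hkb
      hκΩ.le hκV.le hbΩ hbV hε
    refine ⟨δ, hδ, fun T hT x hx hdist t ht => ?_⟩
    obtain ⟨z, hz, hxz⟩ := hx.exists_isErrSolution hy0 (fun t ht => hmem t₀ ht₀ t ht.1)
      (fun t ht => (hode t₀ ht₀ t ht.1).mono Icc_subset_Ici_self)
    rw [hxz t₀ ⟨le_rfl, hT⟩, dist_eq_errDist] at hdist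
    rw [hxz t ht, dist_eq_errDist]
    exact h t₀ T z hT hz hdist t ht
  · obtain ⟨δ, hδ, h⟩ := IsErrSolution.attractive (κΩ := κΩ) (κV := κV) hobs hyo hk hkb
      hκΩ.le hκV.le hδΩ.le hδV.le hbΩ hbV hA_bdd hX_mem hX_ode hX_bdd
    refine ⟨δ, hδ, fun x hx hdist => ?_⟩
    obtain ⟨z, hz, hxz⟩ := hx.exists_isErrSolution hy0 (hmem t₀ ht₀) (hode t₀ ht₀)
    rw [hxz t₀ self_mem_Ici, dist_eq_errDist] at hdist
    obtain ⟨h1, h2⟩ := h t₀ ht₀ z hz hdist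
    refine (h1.prodMk_nhds h2).congr' ?_
    filter_upwards [eventually_ge_atTop t₀] with t ht
    exact (hxz t ht).symm
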